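/- Let $N\ge 1$ and let $M$ be either a simply connected open subset of $\mathbb C^N$, with $\mathcal O(M)$ the ring of analytic functions on $M$, or the formal neighbourhood of a point $t_{\mathrm{orig}}\in\mathbb C^N$, with $\mathcal O(M)$ the ring of formal power series in $t^\alpha-t^\alpha_{\mathrm{orig}}$. All Greek indices run over $1,\dots,N$ and repeated Greek indices are summed over, except that no summation is made over the index of $q^\alpha$, $\mu^\alpha$ or $E^\alpha$ in their definitions. Consider a conformal flat F-manifold on $M$ given by a vector potential, that is, functions $F^1,\dots,F^N\in\mathcal O(M)$ such that, with $c^\alpha_{\beta\gamma}:=\frac{\partial^2F^\alpha}{\partial t^\beta\partial t^\gamma}$, $$c^\alpha_{1\beta}=\delta^\alpha_\beta,\qquad c^\alpha_{\beta\mu}c^\mu_{\gamma\delta}=c^\alpha_{\gamma\mu}c^\mu_{\beta\delta},$$ and an Euler vector field $E=E^\gamma\frac{\partial}{\partial t^\gamma}$, $E^\gamma=(1-q^\gamma)t^\gamma+r^\gamma$, $q^\gamma,r^\gamma\in\mathbb C$, $q^1=0$, such that $E^\mu\frac{\partial F^\alpha}{\partial t^\mu}=(2-q^\alpha)F^\alpha+A^\alpha_\beta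 t^\beta+B^\alpha$ for some constants $A^\alpha_\beta,B^\alpha\in\mathbb C$. Put $Q:=\mathrm{diag}(q^1,\dots,q^N)$ and $C_\gamma:=(c^\alpha_{\gamma\beta})$ (the upper index is the row index of a matrix). Let a homogeneous calibration be given: $N\times N$ matrices $\Omega^d_0=(\Omega^{\alpha,d}_{\beta,0})$, $d\ge-1$, over $\mathcal O(M)$ and complex matrices $R_n$, $n\ge1$, with $\Omega^{-1}_0=\mathrm{Id}$, $[Q,R_n]=nR_n$ and $$\frac{\partial\Omega^d_0}{\partial t^\gamma}=\Omega^{d-1}_0C_\gamma\ \ (d\ge0),\qquad E^\theta\frac{\partial\Omega^d_0}{\partial t^\theta}=(d+1)\Omega^d_0+[\Omega^d_0,Q]+\sum_{i=1}^{d+1}(-1)^{i-1}R_i\Omega^{d-i}_0\ \ (d\ge-1).$$ Put $R:=\sum_{n\ge1}R_n$ (a finite sum). Define $\Omega^0_d=(\Omega^{\alpha,0}_{\beta,d})$, $d\ge-1$, by $\Omega^0_{-1}:=\mathrm{Id}$ and $$\Bigl(\mathrm{Id}+\sum_{d\ge1}(-1)^d\Omega^0_{d-1}z^d\Bigr)\Bigl(\mathrm{Id}+\sum_{d\ge1}\Omega^{d-1}_0z^d\Bigr)=\mathrm{Id},$$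 and for $p,q\ge0$ put $\Omega^p_q=(\Omega^{\alpha,p}_{\beta,q}):=\sum_{i=0}^q(-1)^{q-i}\Omega^{p+q-i}_0\Omega^0_{i-1}$. The functions $\Omega^{\alpha,0}_{1,0}-t^\alpha$ are constant; write $t^\alpha_0:=\Omega^{\alpha,0}_{1,0}$ for the flat coordinates shifted by these constants, and use the $t^\alpha_0$ as the coordinates on $M$ from now on. Let $t^\alpha_d$, $d\ge1$, be formal variables, $\widetilde t^\alpha_d:=t^\alpha_d-\delta^{\alpha,1}\delta_{d,1}$ for $d\ge 0$, and $x:=t^1_0$. Let $v^\top=((v^\top)^1,\dots,(v^\top)^N)$, $(v^\top)^\alpha\in\mathcal O(M)[[t^*_{\ge1}]]$, be the solution of the principal hierarchy $$\frac{\partial v^\alpha}{\partial t^\beta_d}=\partial_x\bigl(\Omega^{\alpha,0}_{\beta,d}\big|_{t^\gamma_0\mapsto v^\gamma}\bigr),\quad d\ge0,\qquad v^\alpha\big|_{t^*_{\ge1}=0}=t^\alpha_0 .$$ Put $(\Omega^\top)^{\alpha,p}_{\beta,q}:=\Omega^{\alpha,p}_{\beta,q}\big|_{t^\gamma_0\mapsto(v^\top)^\gamma}$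 (also for $p=0$, $q=-1$), and define the descendent vector potentials by $$\mathcal F^{\alpha,p}:=\sum_{q\ge0}(\Omega^\top)^{\alpha,p}_{\beta,q}\,\widetilde t^\beta_q\ \ (p\ge0),\qquad \mathcal F^{\alpha,p}:=(-1)^{p+1}\,\widetilde t^\alpha_{-p-1}\ \ (p<0).$$ Let $\lambda\in\mathbb C$, $\mu^\alpha:=q^\alpha+\lambda-\frac32$, $\mu:=\mathrm{diag}(\mu^1,\dots,\mu^N)$. For a complex $N\times N$ matrix $A$ let $P_{-1}(A,R):=\mathrm{Id}$, $P_{m+1}(A,R):=RP_m(A,R)+P_m(A,R)\bigl(A+m+\frac12\bigr)$ for $m\ge-1$, and for $p\in\mathbb Z$ let $[A]_p$ be the matrix with entries $([A]_p)^\alpha_\beta=A^\alpha_\beta$ if $q^\alpha-q^\beta=p$ and $0$ otherwise. For $m\ge-1$ put $$A^\alpha_m:=\sum_{d_1\ge-1,\ d_2\in\mathbb Z}(-1)^{d_2+1}\bigl([P_m(\mu-d_2,R)]_{m-1-d_1-d_2}\bigr)^\gamma_\nu\,(\Omega^\top)^{\alpha,0}_{\gamma,d_1}\,\mathcal F^{\nu,d_2}.$$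 **Proposition.** For all $1\le\alpha\le N$, all $m\ge-1$ and all $\lambda\in\mathbb C$, the sum defining $A^\alpha_m$ is well defined in $\mathcal O(M)[[t^*_{\ge1}]]$ (each monomial in the variables $t^*_{\ge1}$ occurs in only finitely many of its terms), and $A^\alpha_m=0$. -/

import Mathlib

open scoped BigOperators

noncomputable section

/-! ### Rings of functions on a (possibly formal) domain of `ℂ^N` -/

/-- A ring of functions in the coordinates `t^α`: a commutative `ℂ`-algebra with the coordinate
functions and the commuting partial derivatives `∂/∂t^α`.  Only the two models
`analyticFunctions` and `formalFunctions` below are used. -/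
structure FunctionAlgebra (N : ℕ) (𝒪 : Type) [CommRing 𝒪] [Algebra ℂ 𝒪] where
  /-- the coordinate functions -/
  coord : Fin N → 𝒪
  /-- the partial derivatives -/
  D : Fin N → Derivation ℂ 𝒪 𝒪
  D_coord : ∀ α β, D α (coord β) = if α = β then 1 else 0
  D_comm : ∀ α β f, D α (D β f) = D β (D α f)

/-- The ring `𝒪(M)` of analytic functions on `M ⊆ ℂ^N`. -/
def AnalyticRing {N : ℕ} (M : Set (Fin N → ℂ)) : Subalgebra ℂ (M → ℂ) where
  carrier := {f | ∃ g : (Fin N → ℂ) → ℂ, AnalyticOnNhd ℂ g M ∧ ∀ x : M, f x = g x}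
  mul_mem' := by
    rintro a b ⟨f, hf, hf'⟩ ⟨g, hg, hg'⟩
    exact ⟨f * g, hf.mul hg, fun x => by simp [hf', hg']⟩
  add_mem' := by
    rintro a b ⟨f, hf, hf'⟩ ⟨g, hg, hg'⟩
    exact ⟨f + g, hf.add hg, fun x => by simp [hf', hg']⟩
  algebraMap_mem' := fun c => ⟨fun _ => c, analyticOnNhd_const, fun _ => rfl⟩

namespace AnalyticRing

variable {N : ℕ} {M : Set (Fin N → ℂ)}

/-- Extension by zero of a function on `M`. -/
def ext (f : M → ℂ) : (Fin N → ℂ) → ℂ := Function.extend Subtype.val f 0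

theorem ext_apply (f : M → ℂ) (x : M) : ext f x = f x :=
  Subtype.val_injective.extend_apply f 0 x

theorem ext_eventuallyEq (hM : IsOpen M) {f : M → ℂ} {g : (Fin N → ℂ) → ℂ}
    (h : ∀ x : M, f x = g x) (x : M) : ext f =ᶠ[nhds (x : Fin N → ℂ)] g := by
  filter_upwards [hM.mem_nhds x.2] with y hy
  rw [ext_apply f ⟨y, hy⟩, h]

theorem analyticAt_ext (hM : IsOpen M) (f : AnalyticRing M) (x : M) :
    AnalyticAt ℂ (ext f.1) x := by
  obtain ⟨g, hg, hfg⟩ := f.2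
  exact (hg x x.2).congr (ext_eventuallyEq hM hfg x).symm

/-- The partial derivative `∂f/∂t^α` of an analytic function `f` on the open set `M`. -/
def pd (hM : IsOpen M) (α : Fin N) (f : AnalyticRing M) : AnalyticRing M :=
  ⟨fun x => fderiv ℂ (ext f.1) x (Pi.single α 1),
    fun x => fderiv ℂ (ext f.1) x (Pi.single α 1),
    fun x hx => by
      have h := (analyticAt_ext hM f ⟨x, hx⟩).fderiv
      exact ((ContinuousLinearMap.apply ℂ ℂ (Pi.single α (1 : ℂ))).analyticAt _).comp h,
    fun _ => rfl⟩

theorem pd_apply (hM : IsOpen M) (α : Fin N) (f : AnalyticRing M) {g : (Fin N → ℂ) → ℂ}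
    (h : ∀ x : M, f.1 x = g x) (x : M) :
    (pd hM α f).1 x = fderiv ℂ g x (Pi.single α 1) := by
  change fderiv ℂ (ext f.1) x (Pi.single α 1) = _
  rw [(ext_eventuallyEq hM h x).fderiv_eq]

/-- `∂/∂t^α` as a derivation of `𝒪(M)`. -/
def pderiv (hM : IsOpen M) (α : Fin N) : Derivation ℂ (AnalyticRing M) (AnalyticRing M) :=
  Derivation.mk'
    { toFun := pd hM α
      map_add' := fun f g => by
        apply Subtype.ext
        funext x
        rw [pd_apply hM α (f + g) (g := ext f.1 + ext g.1)
          (fun y => by simp [ext_apply]) x,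
          fderiv_add (analyticAt_ext hM f x).differentiableAt
            (analyticAt_ext hM g x).differentiableAt]
        rfl
      map_smul' := fun c f => by
        apply Subtype.ext
        funext x
        rw [pd_apply hM α (c • f) (g := c • ext f.1)
          (fun y => by simp [ext_apply]) x,
          fderiv_const_smul (analyticAt_ext hM f x).differentiableAt]
        rfl }
    (fun f g => by
      apply Subtype.ext
      funext x
      change (pd hM α (f * g)).1 x = _
      rw [pd_apply hM α (f * g) (g := ext f.1 * ext g.1)
          (fun y => by simp [ext_apply]) x,
          fderiv_mul (analyticAt_ext hM f x).differentiableAt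
            (analyticAt_ext hM g x).differentiableAt]
      simp [ext_apply]
      rfl)

theorem pderiv_apply (hM : IsOpen M) (α : Fin N) (f : AnalyticRing M) :
    pderiv hM α f = pd hM α f := rfl

/-- The coordinate function `t^α` on `M`. -/
def coord (M : Set (Fin N → ℂ)) (α : Fin N) : AnalyticRing M :=
  ⟨fun x => x.1 α, fun x => x α,
    (ContinuousLinearMap.proj (R := ℂ) (φ := fun _ : Fin N => ℂ) α).analyticOnNhd _,
    fun _ => rfl⟩

end AnalyticRing

/-- `𝒪(M)` for an open set `M ⊆ ℂ^N`. -/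
def analyticFunctions {N : ℕ} (M : Set (Fin N → ℂ)) (hM : IsOpen M) :
    FunctionAlgebra N (AnalyticRing M) where
  coord := AnalyticRing.coord M
  D := AnalyticRing.pderiv hM
  D_coord := fun α β => by
    apply Subtype.ext
    funext x
    rw [AnalyticRing.pderiv_apply, AnalyticRing.pd_apply hM α _
      (g := ContinuousLinearMap.proj (R := ℂ) (φ := fun _ : Fin N => ℂ) β) (fun _ => rfl),
      ContinuousLinearMap.fderiv]
    by_cases h : α = β
    · subst h; simp
    · simp [h, Ne.symm h]
  D_comm := fun α β f => by
    apply Subtype.ext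
    funext x
    have hf := AnalyticRing.analyticAt_ext hM f x
    have hs : IsSymmSndFDerivAt ℂ (AnalyticRing.ext f.1) x :=
      (hf.contDiffAt (n := ⊤)).isSymmSndFDerivAt_of_omega
    have key : ∀ γ δ : Fin N, (AnalyticRing.pd hM γ (AnalyticRing.pd hM δ f)).1 x =
        fderiv ℂ (fderiv ℂ (AnalyticRing.ext f.1)) x (Pi.single γ 1) (Pi.single δ 1) := by
      intro γ δ
      rw [AnalyticRing.pd_apply hM γ _
        (g := fun y => fderiv ℂ (AnalyticRing.ext f.1) y (Pi.single δ 1)) (fun _ => rfl)]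
      rw [fderiv_clm_apply hf.fderiv.differentiableAt (differentiableAt_const _)]
      simp
    simp only [AnalyticRing.pderiv_apply]
    rw [key, key]
    exact hs.eq _ _

/-- The functions on the formal neighbourhood of the point `t_orig ∈ ℂ^N`: the formal power series
in the variables `X^α = t^α - t^α_orig`. -/
def formalFunctions {N : ℕ} (torig : Fin N → ℂ) :
    FunctionAlgebra N (MvPowerSeries (Fin N) ℂ) where
  coord := fun α => MvPowerSeries.C (torig α) + MvPowerSeries.X α
  D := fun α => MvPowerSeries.pderiv ℂ α
  D_coord := fun α β => by
    by_cases h : α = β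
    · subst h; simp
    · simp [h, MvPowerSeries.pderiv_X_of_ne (Ne.symm h)]
  D_comm := fun α β f => by
    ext n
    simp only [MvPowerSeries.coeff_pderiv]
    by_cases h : α = β
    · subst h; rfl
    · rw [add_right_comm]
      simp [h, Ne.symm h]
      ring

/-! ### Conformal flat F-manifolds and their calibrations

The index `1` of the unit vector field `∂/∂t^1` is `0 : Fin N`. -/

variable {N : ℕ} [NeZero N] {𝒪 : Type} [CommRing 𝒪] [Algebra ℂ 𝒪]

/-- A conformal flat F-manifold given by a vector potential `(F^1, …, F^N)` and an Euler vector
field `E = ∑ ((1 - q^γ) t^γ + r^γ) ∂/∂t^γ`, `q^1 = 0`. -/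
structure ConformalFlatFManifold (𝒜 : FunctionAlgebra N 𝒪) where
  /-- the vector potential -/
  F : Fin N → 𝒪
  unit : ∀ α β, 𝒜.D 0 (𝒜.D β (F α)) = if α = β then 1 else 0
  assoc : ∀ α β γ δ,
    ∑ μ, 𝒜.D β (𝒜.D μ (F α)) * 𝒜.D γ (𝒜.D δ (F μ)) =
      ∑ μ, 𝒜.D γ (𝒜.D μ (F α)) * 𝒜.D β (𝒜.D δ (F μ))
  q : Fin N → ℂ
  r : Fin N → ℂ
  q_unit : q 0 = 0
  homogeneous : ∃ (A : Matrix (Fin N) (Fin N) ℂ) (B : Fin N → ℂ), ∀ α,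
    ∑ μ, ((1 - q μ) • 𝒜.coord μ + algebraMap ℂ 𝒪 (r μ)) * 𝒜.D μ (F α) =
      (2 - q α) • F α + ∑ β, A α β • 𝒜.coord β + algebraMap ℂ 𝒪 (B α)

/-- The extension of a complex matrix to a matrix of (constant) functions. -/
def constMatrix (𝒪 : Type) [CommRing 𝒪] [Algebra ℂ 𝒪] (A : Matrix (Fin N) (Fin N) ℂ) :
    Matrix (Fin N) (Fin N) 𝒪 :=
  A.map (algebraMap ℂ 𝒪)

namespace ConformalFlatFManifold

variable {𝒜 : FunctionAlgebra N 𝒪} (X : ConformalFlatFManifold 𝒜)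

/-- The component `E^γ = (1 - q^γ) t^γ + r^γ` of the Euler vector field. -/
def euler (γ : Fin N) : 𝒪 := (1 - X.q γ) • 𝒜.coord γ + algebraMap ℂ 𝒪 (X.r γ)

/-- The matrix `C_γ = (c^α_{γβ})`, `c^α_{γβ} = ∂²F^α/∂t^γ∂t^β` (row `α`, column `β`). -/
def C (γ : Fin N) : Matrix (Fin N) (Fin N) 𝒪 :=
  Matrix.of fun α β => 𝒜.D γ (𝒜.D β (X.F α))

/-- `Q = diag(q^1, …, q^N)`. -/
def Q : Matrix (Fin N) (Fin N) ℂ := Matrix.diagonal X.q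

/-- A (homogeneous) calibration of a conformal flat F-manifold.  The index is shifted by one:
`Om e` is the matrix `Ω^{e-1}_0`, with row `α` and column `β` entry `Ω^{α,e-1}_{β,0}`.
The matrices `R n` matter only for `n ≥ 1`. -/
structure Calibration where
  Om : ℕ → Matrix (Fin N) (Fin N) 𝒪
  R : ℕ → Matrix (Fin N) (Fin N) ℂ
  Om_zero : Om 0 = 1
  deriv_Om : ∀ e γ, (Om (e + 1)).map (𝒜.D γ) = Om e * X.C γ
  comm_R : ∀ n, 1 ≤ n → X.Q * R n - R n * X.Q = (n : ℂ) • R n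
  homogeneous : ∀ e : ℕ,
    ∑ θ, X.euler θ • (Om e).map (𝒜.D θ) =
      (e : ℂ) • Om e + (Om e * constMatrix 𝒪 X.Q - constMatrix 𝒪 X.Q * Om e)
        + ∑ i ∈ Finset.Icc 1 e, (-1 : ℂ) ^ (i + 1) • (constMatrix 𝒪 (R i) * Om (e - i))

end ConformalFlatFManifold

/-! ### Formal power series in the descendent variables

The variable `(β, k)` of `MvPowerSeries (Fin N × ℕ) 𝒪` is `t^β_{k+1}`; the variables `t^β_0` are in
the coefficient ring `𝒪`. -/

/-- The ring `𝒪(M)[[t^*_{≥1}]]`. -/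
abbrev DescRing (N : ℕ) (𝒪 : Type) : Type := MvPowerSeries (Fin N × ℕ) 𝒪

/-- A family of power series is locally finite if each monomial occurs in finitely many members,
so that the sum of the family is well defined. -/
def LocallyFiniteFamily {ι : Type} (f : ι → DescRing N 𝒪) : Prop :=
  ∀ n : Fin N × ℕ →₀ ℕ, (Function.support fun i => MvPowerSeries.coeff n (f i)).Finite

/-- The sum of a locally finite family of power series. -/
def formalSum {ι : Type} (f : ι → DescRing N 𝒪) : DescRing N 𝒪 :=
  fun n => ∑ᶠ i, MvPowerSeries.coeff n (f i)

namespace FunctionAlgebra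

variable (𝒜 : FunctionAlgebra N 𝒪)

/-- `∂/∂t^β_d` on `𝒪(M)[[t^*_{≥1}]]`. -/
def ddt (β : Fin N) : ℕ → DescRing N 𝒪 → DescRing N 𝒪
  | 0 => fun f n => 𝒜.D β (MvPowerSeries.coeff n f)
  | k + 1 => fun f => MvPowerSeries.pderiv 𝒪 (β, k) f

/-- The higher partial derivative `∏ (∂/∂t^α)^{k_α}`. -/
def iterD (k : Fin N →₀ ℕ) : Module.End ℂ 𝒪 :=
  (List.ofFn fun α => ((𝒜.D α : 𝒪 →ₗ[ℂ] 𝒪) : Module.End ℂ 𝒪) ^ k α).prod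

/-- The Taylor series `∑_k (1/k!) (∂^k f) w^k` of `f(t + w)` in new variables `w^1, …, w^N`. -/
def taylor (f : 𝒪) : MvPowerSeries (Fin N) 𝒪 :=
  fun k => ((∏ α, (k α).factorial : ℕ) : ℂ)⁻¹ • 𝒜.iterD k f

end FunctionAlgebra

namespace ConformalFlatFManifold.Calibration

variable {𝒜 : FunctionAlgebra N 𝒪} {X : ConformalFlatFManifold 𝒜} (K : X.Calibration)

/-- The matrices `Ω^0_d`, with index shifted by one: `K.Lo e` is `Ω^0_{e-1}`.  They are determined
by `(∑ (-1)^d Ω^0_{d-1} z^d) (∑ Ω^{d-1}_0 z^d) = Id`, see `sum_Lo_mul_Om`. -/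
def Lo : ℕ → Matrix (Fin N) (Fin N) 𝒪
  | 0 => 1
  | e + 1 => (-1 : ℂ) ^ e • ∑ i : Fin (e + 1), (-1 : ℂ) ^ (i : ℕ) • (Lo i * K.Om (e + 1 - i))

theorem sum_Lo_mul_Om (e : ℕ) :
    ∑ i ∈ Finset.range (e + 1), (-1 : ℂ) ^ i • (K.Lo i * K.Om (e - i)) =
      if e = 0 then 1 else 0 := by
  cases e with
  | zero => simp [Lo, K.Om_zero]
  | succ e =>
    rw [Finset.sum_range_succ]
    have h : K.Lo (e + 1) = (-1 : ℂ) ^ e •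
        ∑ i ∈ Finset.range (e + 1), (-1 : ℂ) ^ i • (K.Lo i * K.Om (e + 1 - i)) := by
      rw [Lo, ← Fin.sum_univ_eq_sum_range
        (fun i => (-1 : ℂ) ^ i • (K.Lo i * K.Om (e + 1 - i)))]
    rw [Nat.sub_self, K.Om_zero, mul_one, h, smul_smul]
    have h2 : (-1 : ℂ) ^ (e + 1) * (-1 : ℂ) ^ e = -1 := by
      rw [← pow_add, show e + 1 + e = 2 * e + 1 by ring, pow_succ, pow_mul]
      simp
    rw [h2]
    simp

/-- `R = ∑_{n ≥ 1} R_n`, a sum with finitely many non-zero terms, see `finite_R`. -/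
def Rtot : Matrix (Fin N) (Fin N) ℂ := ∑ᶠ (n : ℕ) (_ : 1 ≤ n), K.R n

theorem finite_R : {n : ℕ | 1 ≤ n ∧ K.R n ≠ 0}.Finite := by
  have hfin : (⋃ p : Fin N × Fin N, {n : ℕ | X.q p.1 - X.q p.2 = n}).Finite := by
    refine Set.finite_iUnion fun p => Set.Subsingleton.finite ?_
    intro a ha b hb
    have : (a : ℂ) = b := (Eq.symm ha).trans hb
    exact_mod_cast this
  refine hfin.subset ?_
  rintro n ⟨hn, hR⟩
  by_contra hcon
  simp only [Set.mem_iUnion, Set.mem_ofPred_eq, not_exists] at hcon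
  apply hR
  ext α β
  have h := congrFun (congrFun (K.comm_R n hn) α) β
  simp only [ConformalFlatFManifold.Q, Matrix.sub_apply, Matrix.diagonal_mul,
    Matrix.mul_diagonal, Matrix.smul_apply, smul_eq_mul] at h
  have h' : (X.q α - X.q β - n) * K.R n α β = 0 := by linear_combination h
  rcases mul_eq_zero.mp h' with h0 | h0
  · exact absurd (sub_eq_zero.mp h0) (hcon (α, β))
  · exact h0

/-- The flat coordinate `t^α_0 := Ω^{α,0}_{1,0}` normalized by the calibration.  It differs from
the coordinate `t^α` by a constant (see `D_flatCoord`), so that `∂/∂t^β_0 = ∂/∂t^β`. -/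
def flatCoord (α : Fin N) : 𝒪 := K.Lo 1 α 0

theorem D_flatCoord (α β : Fin N) : 𝒜.D β (K.flatCoord α) = if α = β then 1 else 0 := by
  have h1 : K.flatCoord α = K.Om 1 α 0 := by simp [flatCoord, Lo]
  have h2 := congrFun (congrFun (K.deriv_Om 0 β) α) 0
  rw [K.Om_zero, one_mul] at h2
  simp only [zero_add, Matrix.map_apply] at h2
  rw [h1, h2]
  change 𝒜.D β (𝒜.D 0 (X.F α)) = _
  rw [𝒜.D_comm, X.unit]

/-- The substitution `f ↦ f|_{t^γ ↦ v^γ}`, for `v^γ = t^γ_0 + (terms of positive degree in the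
variables t^*_{≥1})`, by Taylor expansion of `f` around the point `t_0`. -/
def substV (v : Fin N → DescRing N 𝒪) (f : 𝒪) : DescRing N 𝒪 :=
  MvPowerSeries.subst (fun γ => v γ - MvPowerSeries.C (K.flatCoord γ)) (𝒜.taylor f)

/-- `v` is the topological solution `v^⊤` of the principal hierarchy
`∂v^α/∂t^β_d = ∂_x (Ω^{α,0}_{β,d}|_{t ↦ v})`, `x = t^1_0`, with `v^α|_{t^*_{≥1} = 0} = t^α_0`. -/
structure IsTopologicalSolution (v : Fin N → DescRing N 𝒪) : Prop where
  initial : ∀ α, MvPowerSeries.constantCoeff (v α) = K.flatCoord α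
  hierarchy : ∀ (α β : Fin N) (d : ℕ),
    𝒜.ddt β d (v α) = 𝒜.ddt 0 0 (K.substV v (K.Lo (d + 1) α β))

/-- The matrices `Ω^p_q = ∑_{i=0}^q (-1)^{q-i} Ω^{p+q-i}_0 Ω^0_{i-1}`, `p, q ≥ 0`. -/
def Omega (p q : ℕ) : Matrix (Fin N) (Fin N) 𝒪 :=
  ∑ i ∈ Finset.range (q + 1), (-1 : ℂ) ^ (q - i) • (K.Om (p + q - i + 1) * K.Lo i)

/-- The dilaton shifted variable `t^β_d - δ^{β,1} δ_{d,1}`. -/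
def shiftedVar (β : Fin N) : ℕ → DescRing N 𝒪
  | 0 => MvPowerSeries.C (K.flatCoord β)
  | k + 1 => MvPowerSeries.X (β, k) - if β = 0 ∧ k = 0 then 1 else 0

/-- The term `(Ω^⊤)^{α,p}_{β,q} (t^β_q - δ^{β,1} δ_{q,1})` of the descendent vector potential. -/
def potentialTerm (v : Fin N → DescRing N 𝒪) (α : Fin N) (p : ℕ) (i : Fin N × ℕ) :
    DescRing N 𝒪 :=
  K.substV v (K.Omega p i.2 α i.1) * K.shiftedVar i.1 i.2

/-- The descendent vector potentials `ℱ^{α,p}`, with the convention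
`ℱ^{α,p} = (-1)^{p+1} (t^α_{-p-1} - δ^{α,1} δ_{-p-1,1})` for `p < 0`. -/
def potential (v : Fin N → DescRing N 𝒪) (α : Fin N) : ℤ → DescRing N 𝒪
  | Int.ofNat p => formalSum (K.potentialTerm v α p)
  | Int.negSucc n => (-1) ^ n * K.shiftedVar α n

theorem locallyFinite_potentialTerm (v : Fin N → DescRing N 𝒪) (α : Fin N) (p : ℕ) :
    LocallyFiniteFamily (K.potentialTerm v α p) := by
  classical
  intro n
  have hfin : ((Set.univ : Set (Fin N)) ×ˢ (Set.Iic 1 : Set ℕ) ∪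
      (fun j : Fin N × ℕ => (j.1, j.2 + 1)) '' (n.support : Set (Fin N × ℕ))).Finite :=
    (Set.finite_univ.prod (Set.finite_Iic 1)).union (n.support.finite_toSet.image _)
  refine hfin.subset ?_
  rintro ⟨β, q⟩ hq
  by_contra hcon
  simp only [Set.mem_union, not_or] at hcon
  obtain ⟨h1, h2⟩ := hcon
  have hq1 : 1 < q := by
    by_contra h
    exact h1 ⟨Set.mem_univ _, Set.mem_Iic.mpr (not_lt.mp h)⟩
  obtain ⟨k, rfl⟩ : ∃ k, q = k + 1 := ⟨q - 1, by omega⟩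
  have hk : k ≠ 0 := by omega
  have hn : n (β, k) = 0 := by
    by_contra h
    exact h2 ⟨(β, k), by simpa using h, rfl⟩
  apply hq
  simp only [potentialTerm, shiftedVar, hk, and_false, if_false, sub_zero]
  rw [mul_comm]
  exact (MvPowerSeries.X_dvd_iff.mp (dvd_mul_right (MvPowerSeries.X (β, k)) _)) n hn

end ConformalFlatFManifold.Calibration

/-! ### The Virasoro expressions -/

/-- The matrices `P_m(A, R)`, with index shifted by one: `virP A R k` is `P_{k-1}(A, R)`, so that
`P_{-1} = Id` and `P_{m+1} = R P_m + P_m (A + m + 1/2)`. -/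
def virP (A R : Matrix (Fin N) (Fin N) ℂ) : ℕ → Matrix (Fin N) (Fin N) ℂ
  | 0 => 1
  | k + 1 => R * virP A R k + virP A R k * (A + ((k : ℂ) - 1 + 1 / 2) • 1)

/-- The matrix `[A]_p`: the entries `A^α_β` with `q^α - q^β = p` are kept, the others are replaced
by zero. -/
def qPart (q : Fin N → ℂ) (p : ℤ) (A : Matrix (Fin N) (Fin N) ℂ) : Matrix (Fin N) (Fin N) ℂ :=
  open Classical in Matrix.of fun α β => if q α - q β = (p : ℂ) then A α β else 0

namespace ConformalFlatFManifold.Calibration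

variable {𝒜 : FunctionAlgebra N 𝒪} {X : ConformalFlatFManifold 𝒜} (K : X.Calibration)

/-- `μ = diag(μ^1, …, μ^N)`, `μ^α = q^α + λ - 3/2`. -/
def mu (X : ConformalFlatFManifold 𝒜) (lam : ℂ) : Matrix (Fin N) (Fin N) ℂ :=
  Matrix.diagonal fun α => X.q α + lam - 3 / 2

/-- The term
`(-1)^{d₂+1} ([P_m(μ - d₂, R)]_{m-1-d₁-d₂})^γ_ν (Ω^⊤)^{α,0}_{γ,d₁} ℱ^{ν,d₂}`
of `A^α_m`, for the index `i = (γ, ν, k, d₂)` with `d₁ = k - 1 ≥ -1` and `d₂ ∈ ℤ`. -/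
def virasoroTerm (v : Fin N → DescRing N 𝒪) (lam : ℂ) (m : ℤ) (α : Fin N)
    (i : Fin N × Fin N × ℕ × ℤ) : DescRing N 𝒪 :=
  let γ := i.1
  let ν := i.2.1
  let k := i.2.2.1
  let d₁ : ℤ := (k : ℤ) - 1
  let d₂ := i.2.2.2
  ((-1 : ℂ) ^ (d₂ + 1) *
      qPart X.q (m - 1 - d₁ - d₂) (virP (mu X lam - (d₂ : ℂ) • 1) K.Rtot (m + 1).toNat) γ ν) •
    (K.substV v (K.Lo k α γ) * K.potential v ν d₂)

/-- The expression `A^α_m`, `m ≥ -1`, depending on the parameter `λ`. -/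
def virasoroExpr (v : Fin N → DescRing N 𝒪) (lam : ℂ) (m : ℤ) (α : Fin N) : DescRing N 𝒪 :=
  formalSum (K.virasoroTerm v lam m α)

end ConformalFlatFManifold.Calibration

end

open scoped BigOperators

noncomputable section

set_option linter.unusedSectionVars false

/-! ### Derivations and substitution of formal power series -/

section

/-! Fix D ≥ 1 and work modulo the variables t^*_d with d > D; every monomial survives for some D,
and only finitely many terms of A^α_m survive for a given D. In one auxiliary variable z put T = ∑
Ω^0_{e-1} z^e and S = ∑ (-1)^e Ω^{e-1}_0 z^e, both evaluated along v^⊤, so that T S = S T = 1. Let H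
= ∑_{k=0}^{D} u_k z^{D-k} with u_k = ∑_q Ω^0_{q-1} t̃_{q+k}. Three facts carry the proof.

Euler–Lagrange equation (`truncSum_mem`): u_0 = 0, so H has degree < D. Indeed u_0 vanishes at
t^*_{≥1} = 0, and by the hierarchy it satisfies the linear homogeneous system ∂u_0/∂t^β_d = ∂_x u_0
⋆ Ω^0_{d-1} e_β, which propagates this zero.

Potentials (`coeff_altSeries_mul_reducedSeries`): the coefficient of z^i in S H is (-1)^{d+1}
ℱ^{•,d} with d = i - D - 1, for negative and non-negative d alike.

Virasoro operators (`sum_virP_mul_eq_zero`): let G_j = ∑_i z^i [P_{j-1}(μ - d, R)](z) (S H)_i, where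
[P](z) = ∑_n [P]_n z^n. In these generating series, right multiplication by Q becomes left
multiplication by Q - z d/dz. The recursion for P then reads G_{j+1} = (Q + R(z) + c - z d/dz) G_j,
with c = D + j + λ - 1 the same for every i. Homogeneity of the calibration says that conjugation by
S turns this operator into Q + zU + c - z d/dz, where U is multiplication by E. The latter raises
degrees by at most one. Since T G_0 = H has degree < D, the series T G_j has degree < D + j. Its
coefficient of z^{D+j} is A_m with m = j - 1, which therefore vanishes. -/

theorem List.prod_ofFn_update_mul {A : Type*} [Monoid A] :
    ∀ {n : ℕ} (g : Fin n → A) (a : Fin n) (x : A), (∀ i, Commute x (g i)) →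
      (List.ofFn (Function.update g a (g a * x))).prod = (List.ofFn g).prod * x
  | 0, _, a, _, _ => a.elim0
  | n + 1, g, a, x, h => by
    rw [List.ofFn_succ, List.ofFn_succ, List.prod_cons, List.prod_cons]
    refine Fin.cases ?_ (fun b => ?_) a
    · have hc : Commute x (List.ofFn fun i : Fin n => g i.succ).prod :=
        Commute.list_prod_right _ _ (by
          intro y hy
          obtain ⟨i, rfl⟩ := List.mem_ofFn.mp hy
          exact h _)
      simp only [Function.update_self, ne_eq, Fin.succ_ne_zero, not_false_eq_true,
        Function.update_of_ne]
      rw [mul_assoc, hc.eq, mul_assoc]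
    · have ih := List.prod_ofFn_update_mul (fun i : Fin n => g i.succ) b x (fun i => h _)
      rw [mul_assoc, ← ih, Function.update_of_ne (Fin.succ_ne_zero b).symm]
      congr 3
      funext i
      by_cases hi : i = b
      · subst hi; simp
      · simp [hi]

namespace MvPowerSeries

variable {σ A : Type*} [CommRing A] [Algebra ℂ A]

/-- The coefficientwise action of a derivation of the coefficient ring. -/
def mapDerivation (σ : Type*) (δ : Derivation ℂ A A) :
    Derivation ℂ (MvPowerSeries σ A) (MvPowerSeries σ A) :=
  let F : MvPowerSeries σ A → MvPowerSeries σ A := fun f n => δ (coeff n f)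
  have hF : ∀ f n, coeff n (F f) = δ (coeff n f) := fun _ _ => rfl
  Derivation.mk'
    { toFun := F
      map_add' := fun f g => by
        ext n
        simp only [hF, map_add]
      map_smul' := fun c f => by
        ext n
        exact δ.map_smul c (coeff n f) }
    (fun f g => by
      classical
      ext n
      change coeff n (F (f * g)) = coeff n (f * F g + g * F f)
      rw [hF, coeff_mul, map_sum, map_add, coeff_mul, mul_comm g,
        coeff_mul, ← Finset.sum_add_distrib]
      refine Finset.sum_congr rfl fun p _ => ?_
      rw [Derivation.leibniz, smul_eq_mul, smul_eq_mul, mul_comm (coeff p.2 g), hF, hF])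

@[simp]
theorem coeff_mapDerivation (δ : Derivation ℂ A A) (f : MvPowerSeries σ A) (n : σ →₀ ℕ) :
    coeff n (mapDerivation σ δ f) = δ (coeff n f) := rfl

theorem mapDerivation_C (δ : Derivation ℂ A A) (a : A) :
    mapDerivation σ δ (C a) = C (δ a) := by
  classical
  ext n
  rw [coeff_mapDerivation, coeff_C, coeff_C]
  split_ifs <;> simp

/-- The chain rule for substitution. -/
theorem derivation_subst {τ : Type*} [Fintype σ] {w : σ → MvPowerSeries τ A}
    (hw : ∀ s, constantCoeff (w s) = 0)
    (Δ : Derivation ℂ (MvPowerSeries τ A) (MvPowerSeries τ A)) (δ : Derivation ℂ A A)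
    (hC : ∀ a, Δ (C a) = C (δ a))
    (hloc : ∀ (M : ℕ) f, ((M + 1 : ℕ) : ℕ∞) ≤ f.order → (M : ℕ∞) ≤ (Δ f).order)
    (h : MvPowerSeries σ A) :
    Δ (subst w h) = subst w (mapDerivation σ δ h) +
      ∑ s, subst w (pderiv A s h) * Δ (w s) := by
  classical
  have hs : HasSubst w := hasSubst_of_constantCoeff_zero hw
  set S := substAlgHom (R := A) hs with hS
  have hSe : ∀ f, subst w f = S f := fun f => by rw [hS, substAlgHom_apply]
  simp only [hSe]
  have hSC : ∀ a : A, S (C a) = C a := fun a => by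
    have := substAlgHom_monomial (R := A) hs 0 a
    rw [monomial_zero_eq_C_apply] at this
    rw [hS, this, Finsupp.prod_zero_index, mul_one, algebraMap_apply, Algebra.algebraMap_self_apply]
  have hSX : ∀ s, S (X s) = w s := fun s => substAlgHom_X hs s
  -- the formula for polynomials
  have hpol : ∀ p : MvPolynomial σ A, Δ (S p) = S (mapDerivation σ δ p) +
      ∑ s, S (pderiv A s p) * Δ (w s) := by
    intro p
    induction p using MvPolynomial.induction_on with
    | C a =>
      rw [MvPolynomial.coe_C, hSC, hC, mapDerivation_C, hSC]
      simp
    | add p q hp hq =>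
      simp only [MvPolynomial.coe_add, map_add, hp, hq, add_mul, Finset.sum_add_distrib]
      ring
    | mul_X p s hp =>
      simp only [MvPolynomial.coe_mul, MvPolynomial.coe_X, map_mul, Derivation.leibniz, hSX,
        smul_eq_mul, map_add, hp, add_mul, Finset.sum_add_distrib]
      have h1 : mapDerivation σ δ (X s) = 0 := by
        ext n
        rw [coeff_mapDerivation, coeff_X]
        split_ifs <;> simp
      have h2 : ∑ x, S ↑p * S (pderiv A x (X s)) * Δ (w x) = S ↑p * Δ (w s) := by
        rw [Finset.sum_eq_single s]
        · simp
        · intro b _ hb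
          rw [pderiv_X_of_ne hb.symm]; simp
        · simp
      rw [h1, h2]
      simp only [map_zero, mul_zero, zero_add, mul_assoc, ← Finset.mul_sum]
      ring
  -- reduction to polynomials
  have hord : ∀ f, f.order ≤ (S f).order := fun f => by
    rw [← hSe]
    refine le_trans ?_ (le_order_subst hs f)
    exact le_mul_of_one_le_left' (le_iInf fun s =>
      one_le_order_iff_constCoeff_eq_zero.mpr (hw s))
  ext n
  -- A remainder of order at least M + 1 keeps order at least M > deg n after one differentiation,
  -- so the coefficient at n sees only the polynomial part.
  set M := n.degree + 1 with hM
  obtain ⟨p, r, rfl, hr⟩ : ∃ (p : MvPolynomial σ A) (r : MvPowerSeries σ A),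
      h = p + r ∧ ((M + 1 : ℕ) : ℕ∞) ≤ r.order := by
    refine ⟨truncTotal (M + 1) h, h - truncTotal (M + 1) h, by ring, le_order fun d hd => ?_⟩
    rw [map_sub, MvPolynomial.coeff_coe, coeff_truncTotal _ (by exact_mod_cast hd), sub_self]
  have hz : ∀ f : MvPowerSeries τ A, (M : ℕ∞) ≤ f.order → coeff n f = 0 := fun f hf =>
    coeff_of_lt_order (lt_of_lt_of_le (by exact_mod_cast Nat.lt_succ_self _) hf)
  have hδ : (M : ℕ∞) ≤ (mapDerivation σ δ r).order := le_order fun d hd => by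
    rw [coeff_mapDerivation, coeff_of_lt_order, map_zero]
    exact hd.trans_le (le_trans (by exact_mod_cast Nat.le_succ _) hr)
  have hpd : ∀ s, (M : ℕ∞) ≤ (pderiv A s r).order := fun s => le_order fun d hd => by
    rw [coeff_pderiv, coeff_of_lt_order, zero_mul]
    refine lt_of_lt_of_le ?_ hr
    rw [map_add, Finsupp.degree_single]
    exact_mod_cast Nat.succ_lt_succ (by exact_mod_cast hd)
  simp only [map_add, add_mul, Finset.sum_add_distrib, hpol]
  rw [hz _ (hloc M _ (hr.trans (hord _))), hz _ (hδ.trans (hord _)), map_sum (coeff n)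
    (fun s => S (pderiv A s r) * Δ (w s)),
    Finset.sum_eq_zero (f := fun s => coeff n (S (pderiv A s r) * Δ (w s)))]
  · ring
  · intro s _
    exact hz _ (((hpd s).trans (hord _)).trans (le_trans le_self_add le_order_mul))

end MvPowerSeries

end

/-! ### Taylor expansion of functions on M -/

section

variable {N : ℕ} [NeZero N] {𝒪 : Type} [CommRing 𝒪] [Algebra ℂ 𝒪]

namespace FunctionAlgebra

variable (𝒜 : FunctionAlgebra N 𝒪)

theorem iterD_add_single (k : Fin N →₀ ℕ) (α : Fin N) (f : 𝒪) :
    𝒜.iterD (k + Finsupp.single α 1) f = 𝒜.iterD k (𝒜.D α f) := by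
  have hc : ∀ β γ, Commute ((𝒜.D β : 𝒪 →ₗ[ℂ] 𝒪) : Module.End ℂ 𝒪)
      ((𝒜.D γ : 𝒪 →ₗ[ℂ] 𝒪) : Module.End ℂ 𝒪) := fun β γ =>
    LinearMap.ext fun f => 𝒜.D_comm β γ f
  have h := List.prod_ofFn_update_mul
    (fun β => ((𝒜.D β : 𝒪 →ₗ[ℂ] 𝒪) : Module.End ℂ 𝒪) ^ k β) α
    ((𝒜.D α : 𝒪 →ₗ[ℂ] 𝒪) : Module.End ℂ 𝒪) (fun β => (hc α β).pow_right _)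
  have h2 : 𝒜.iterD (k + Finsupp.single α 1) =
      𝒜.iterD k * ((𝒜.D α : 𝒪 →ₗ[ℂ] 𝒪) : Module.End ℂ 𝒪) := by
    rw [iterD, iterD, ← h]
    congr 2
    funext β
    by_cases hβ : β = α
    · subst hβ; simp [pow_succ]
    · simp [hβ]
  rw [h2]
  rfl

theorem iterD_zero (f : 𝒪) : 𝒜.iterD 0 f = f := by
  have : 𝒜.iterD 0 = 1 := by
    rw [iterD]
    refine List.prod_eq_one fun x hx => ?_
    obtain ⟨i, rfl⟩ := List.mem_ofFn.mp hx
    simp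
  rw [this]
  rfl

theorem D_iterD (k : Fin N →₀ ℕ) (α : Fin N) (f : 𝒪) :
    𝒜.D α (𝒜.iterD k f) = 𝒜.iterD k (𝒜.D α f) := by
  have hc : Commute ((𝒜.D α : 𝒪 →ₗ[ℂ] 𝒪) : Module.End ℂ 𝒪) (𝒜.iterD k) := by
    refine Commute.list_prod_right _ _ fun x hx => ?_
    obtain ⟨i, rfl⟩ := List.mem_ofFn.mp hx
    exact Commute.pow_right (LinearMap.ext fun f => 𝒜.D_comm α i f) _
  exact LinearMap.congr_fun hc.eq f

open MvPowerSeries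

theorem coeff_taylor (f : 𝒪) (k : Fin N →₀ ℕ) :
    coeff k (𝒜.taylor f) = ((∏ α, (k α).factorial : ℕ) : ℂ)⁻¹ • 𝒜.iterD k f := rfl

theorem pderiv_taylor (α : Fin N) (f : 𝒪) :
    pderiv 𝒪 α (𝒜.taylor f) = 𝒜.taylor (𝒜.D α f) := by
  ext k
  rw [coeff_pderiv, coeff_taylor, coeff_taylor, iterD_add_single]
  have h1 : ∏ β, ((k + Finsupp.single α 1 : Fin N →₀ ℕ) β).factorial =
      (k α + 1) * ∏ β, (k β).factorial := by
    rw [← Finset.mul_prod_erase _ _ (Finset.mem_univ α),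
      ← Finset.mul_prod_erase _ (fun β => (k β).factorial) (Finset.mem_univ α), ← mul_assoc]
    congr 1
    · simp [Nat.factorial_succ]
    · refine Finset.prod_congr rfl fun β hβ => ?_
      simp [(Finset.ne_of_mem_erase hβ).symm]
  have h2 : ((k α : 𝒪) + 1) = algebraMap ℂ 𝒪 (k α + 1) := by simp
  have h3 : (k α : ℂ) + 1 ≠ 0 := Nat.cast_add_one_ne_zero _
  rw [h1, h2, mul_comm, ← Algebra.smul_def, smul_smul]
  push_cast
  rw [mul_inv, mul_inv_cancel_left₀ h3]

theorem mapDerivation_taylor (α : Fin N) (f : 𝒪) :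
    mapDerivation (Fin N) (𝒜.D α) (𝒜.taylor f) = 𝒜.taylor (𝒜.D α f) := by
  ext k
  rw [coeff_mapDerivation, coeff_taylor, coeff_taylor, Derivation.map_smul, D_iterD]

theorem constantCoeff_taylor (f : 𝒪) : constantCoeff (𝒜.taylor f) = f := by
  rw [← coeff_zero_eq_constantCoeff_apply, coeff_taylor, iterD_zero]
  simp

theorem taylor_add (f g : 𝒪) : 𝒜.taylor (f + g) = 𝒜.taylor f + 𝒜.taylor g := by
  ext k
  simp [coeff_taylor]

theorem isAddTorsionFree (𝒪 : Type) [CommRing 𝒪] [Algebra ℂ 𝒪] : IsAddTorsionFree 𝒪 :=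
  letI : Module ℚ 𝒪 := Module.compHom 𝒪 (algebraMap ℚ ℂ)
  IsAddTorsionFree.of_module_rat _

/-- Coefficients of positive degree can be recovered from a partial derivative because positive
integers act injectively on a ℂ-algebra. This is what allows the inductions on degree below. -/
theorem coeff_succ_eq {σ : Type*} {f g : MvPowerSeries σ 𝒪} {k : σ →₀ ℕ} {s : σ}
    (h : coeff k (pderiv 𝒪 s f) = coeff k (pderiv 𝒪 s g)) :
    coeff (k + Finsupp.single s 1) f = coeff (k + Finsupp.single s 1) g := by
  have := isAddTorsionFree 𝒪
  rw [coeff_pderiv, coeff_pderiv] at h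
  have h2 : ((k s : 𝒪) + 1) = ((k s + 1 : ℕ) : 𝒪) := by push_cast; rfl
  rwa [h2, mul_comm, ← nsmul_eq_mul, mul_comm, ← nsmul_eq_mul,
    smul_right_inj (Nat.succ_ne_zero _)] at h

theorem exists_eq_add_single {σ : Type*} (k : σ →₀ ℕ) (hk : k ≠ 0) :
    ∃ (l : σ →₀ ℕ) (s : σ), k = l + Finsupp.single s 1 := by
  classical
  obtain ⟨s, hs⟩ := Finsupp.ne_iff.mp hk
  refine ⟨k - Finsupp.single s 1, s, (tsub_add_cancel_of_le ?_).symm⟩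
  rw [Finsupp.single_le_iff]
  exact Nat.one_le_iff_ne_zero.mpr hs

/-- By induction on degree: both sides have the same constant term and obey the same Leibniz rule.
-/
theorem taylor_mul (f g : 𝒪) : 𝒜.taylor (f * g) = 𝒜.taylor f * 𝒜.taylor g := by
  ext k
  induction hn : k.degree generalizing k f g with
  | zero =>
    obtain rfl : k = 0 := Finsupp.degree_eq_zero_iff k |>.mp hn
    simp [constantCoeff_taylor]
  | succ n ih =>
    obtain ⟨l, s, rfl⟩ := exists_eq_add_single k (by rintro rfl; simp at hn)
    have hl : l.degree = n := by
      rw [map_add, Finsupp.degree_single] at hn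
      omega
    refine coeff_succ_eq ?_
    rw [pderiv_taylor, Derivation.leibniz, Derivation.leibniz, taylor_add, map_add, map_add,
      smul_eq_mul, smul_eq_mul, smul_eq_mul, smul_eq_mul, ih _ _ _ hl, ih _ _ _ hl,
      pderiv_taylor, pderiv_taylor]

theorem taylor_algebraMap (c : ℂ) :
    𝒜.taylor (algebraMap ℂ 𝒪 c) = C (algebraMap ℂ 𝒪 c) := by
  have := isAddTorsionFree 𝒪
  refine pderiv.ext (fun i => ?_) ?_
  · rw [pderiv_taylor, pderiv_C, Derivation.map_algebraMap]
    ext k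
    simp [coeff_taylor]
  · rw [constantCoeff_taylor, constantCoeff_C]

/-- The derivations `∂/∂t^β_d` of `𝒪(M)[[t^*_{≥1}]]`. -/
def ddtDerivation (β : Fin N) : ℕ → Derivation ℂ (DescRing N 𝒪) (DescRing N 𝒪)
  | 0 => mapDerivation (Fin N × ℕ) (𝒜.D β)
  | k + 1 => (pderiv 𝒪 (β, k)).restrictScalars ℂ

theorem ddt_eq (β : Fin N) (d : ℕ) (f : DescRing N 𝒪) :
    𝒜.ddt β d f = 𝒜.ddtDerivation β d f := by
  cases d <;> rfl

end FunctionAlgebra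

/-! ### Substitution of the topological solution and its chain rule -/

namespace ConformalFlatFManifold.Calibration

open MvPowerSeries

variable {𝒜 : FunctionAlgebra N 𝒪} {X : ConformalFlatFManifold 𝒜} (K : X.Calibration)

variable {K} in
theorem IsTopologicalSolution.constantCoeff_sub {v : Fin N → DescRing N 𝒪}
    (hv : K.IsTopologicalSolution v) (γ : Fin N) :
    constantCoeff (v γ - MvPowerSeries.C (K.flatCoord γ)) = 0 := by
  rw [map_sub, hv.initial, constantCoeff_C, sub_self]

/-- Substitution of the topological solution, as a ring homomorphism. -/
def substHom {v : Fin N → DescRing N 𝒪} (hv : K.IsTopologicalSolution v) :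
    𝒪 →ₐ[ℂ] DescRing N 𝒪 :=
  have hs : HasSubst fun γ => v γ - MvPowerSeries.C (K.flatCoord γ) :=
    hasSubst_of_constantCoeff_zero hv.constantCoeff_sub
  have hC : ∀ c : ℂ, K.substV v (algebraMap ℂ 𝒪 c) = algebraMap ℂ (DescRing N 𝒪) c := fun c => by
    rw [substV, 𝒜.taylor_algebraMap, ← monomial_zero_eq_C_apply, subst_monomial hs,
      Finsupp.prod_zero_index, MvPowerSeries.algebraMap_apply]
    simp [MvPowerSeries.algebraMap_apply]
  { toFun := K.substV v
    map_one' := by simpa using hC 1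
    map_mul' := fun f g => by simp only [substV, 𝒜.taylor_mul, subst_mul hs]
    map_zero' := by simpa using hC 0
    map_add' := fun f g => by simp only [substV, 𝒜.taylor_add, subst_add hs]
    commutes' := hC }

theorem substHom_apply {v : Fin N → DescRing N 𝒪} (hv : K.IsTopologicalSolution v) (f : 𝒪) :
    K.substHom hv f = K.substV v f := rfl

theorem constantCoeff_substHom {v : Fin N → DescRing N 𝒪} (hv : K.IsTopologicalSolution v)
    (f : 𝒪) : constantCoeff (K.substHom hv f) = f := by
  have hs : HasSubst fun γ => v γ - MvPowerSeries.C (K.flatCoord γ) :=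
    hasSubst_of_constantCoeff_zero hv.constantCoeff_sub
  have h : 𝒜.taylor f = (𝒜.taylor f - MvPowerSeries.C f) + MvPowerSeries.C f := by ring
  rw [substHom_apply, substV, h, subst_add hs, map_add,
    constantCoeff_subst_eq_zero hs hv.constantCoeff_sub, zero_add, subst_C, constantCoeff_C]
  rw [map_sub, 𝒜.constantCoeff_taylor, constantCoeff_C, sub_self]

/-- The chain rule for `f|_{t ↦ v}`. -/
theorem ddtDerivation_substHom {v : Fin N → DescRing N 𝒪} (hv : K.IsTopologicalSolution v)
    (β : Fin N) (d : ℕ) (f : 𝒪) :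
    𝒜.ddtDerivation β d (K.substHom hv f) =
      ∑ γ, K.substHom hv (𝒜.D γ f) * 𝒜.ddtDerivation β d (v γ) := by
  cases d with
  | zero =>
    have h := derivation_subst hv.constantCoeff_sub (𝒜.ddtDerivation β 0) (𝒜.D β)
      (fun a => mapDerivation_C _ a) (fun M f hf => le_order fun n hn => by
        change 𝒜.D β (coeff n f) = 0
        rw [coeff_of_lt_order (hn.trans_le (le_trans (by exact_mod_cast Nat.le_succ _) hf)),
          map_zero]) (𝒜.taylor f)
    rw [𝒜.mapDerivation_taylor] at h
    simp only [𝒜.pderiv_taylor] at h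
    refine h.trans ?_
    -- For d = 0 the base point t_0 of the Taylor expansion moves as well. Differentiating w = v -
    -- t_0 contributes an extra -∂_β f along v, which cancels the term coming from the derivative of
    -- the Taylor coefficients.
    have hC : ∀ γ, 𝒜.ddtDerivation β 0 (MvPowerSeries.C (K.flatCoord γ)) = if γ = β then 1 else 0 := by
      intro γ
      change mapDerivation _ _ _ = _
      rw [mapDerivation_C, K.D_flatCoord]
      split_ifs <;> simp
    simp only [map_sub, hC, mul_sub, Finset.sum_sub_distrib]
    simp [substHom_apply, substV]
  | succ k =>
    have h := derivation_subst hv.constantCoeff_sub (𝒜.ddtDerivation β (k + 1)) 0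
      (fun a => by
        change pderiv 𝒪 (β, k) (MvPowerSeries.C a) = _
        simp) (fun M f hf => le_order fun n hn => by
        change coeff n (pderiv 𝒪 (β, k) f) = 0
        rw [coeff_pderiv, coeff_of_lt_order, zero_mul]
        refine lt_of_lt_of_le ?_ hf
        rw [map_add, Finsupp.degree_single]
        exact_mod_cast Nat.succ_lt_succ (by exact_mod_cast hn)) (𝒜.taylor f)
    simp only [𝒜.pderiv_taylor] at h
    refine h.trans ?_
    have h0 : mapDerivation (Fin N) (0 : Derivation ℂ 𝒪 𝒪) (𝒜.taylor f) = 0 := by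
      ext n
      simp
    have hs : HasSubst fun γ => v γ - MvPowerSeries.C (K.flatCoord γ) :=
      hasSubst_of_constantCoeff_zero hv.constantCoeff_sub
    have hC : ∀ γ, 𝒜.ddtDerivation β (k + 1) (MvPowerSeries.C (K.flatCoord γ)) = 0 := fun γ => pderiv_C
    rw [h0, ← substAlgHom_apply (R := 𝒪) hs, map_zero, zero_add]
    simp only [map_sub, hC, sub_zero]
    simp [substHom_apply, substV]

end ConformalFlatFManifold.Calibration

end

/-! ### The multiplication of vector fields, the principal hierarchy and the Euler–Lagrange equation
-/

section

variable {N : ℕ} [NeZero N] {𝒪 : Type} [CommRing 𝒪] [Algebra ℂ 𝒪]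

theorem Matrix.map_derivation_mul (δ : Derivation ℂ 𝒪 𝒪) (A B : Matrix (Fin N) (Fin N) 𝒪) :
    (A * B).map δ = A.map δ * B + A * B.map δ := by
  ext i j
  simp only [Matrix.map_apply, Matrix.mul_apply, map_sum, Matrix.add_apply, Derivation.leibniz,
    smul_eq_mul, ← Finset.sum_add_distrib]
  exact Finset.sum_congr rfl fun k _ => by ring

theorem Matrix.map_derivation_one (δ : Derivation ℂ 𝒪 𝒪) :
    (1 : Matrix (Fin N) (Fin N) 𝒪).map δ = 0 := by
  ext i j
  rw [Matrix.map_apply, Matrix.one_apply]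
  split_ifs <;> simp

namespace MvPowerSeries

variable {σ A : Type*} [CommRing A]

/-- The power series whose coefficients at a set of exponents closed under divisors vanish. -/
def vanishingIdeal (A : Type*) [CommRing A] (U : LowerSet (σ →₀ ℕ)) :
    Ideal (MvPowerSeries σ A) where
  carrier := {f | ∀ n ∈ U, coeff n f = 0}
  zero_mem' := fun n _ => map_zero _
  add_mem' := fun hf hg n hn => by rw [map_add, hf n hn, hg n hn, add_zero]
  smul_mem' := fun c f hf n hn => by
    classical
    rw [smul_eq_mul, coeff_mul]
    refine Finset.sum_eq_zero fun p hp => ?_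
    rw [hf p.2 (U.lower (by
      rw [← Finset.HasAntidiagonal.mem_antidiagonal.mp hp]; exact le_add_self) hn),
      mul_zero]

end MvPowerSeries

namespace ConformalFlatFManifold

variable {𝒜 : FunctionAlgebra N 𝒪} (X : ConformalFlatFManifold 𝒜)

/-- The multiplication of vector fields, after a change of coefficient ring. -/
def star {A : Type*} [CommRing A] [Algebra ℂ A] (S : 𝒪 →ₐ[ℂ] A) (a b : Fin N → A) :
    Fin N → A :=
  fun α => ∑ β, ∑ γ, S (X.C β α γ) * a β * b γ

theorem C_symm (α β γ : Fin N) : X.C β α γ = X.C γ α β := 𝒜.D_comm _ _ _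

section star

variable {A : Type*} [CommRing A] [Algebra ℂ A] (S : 𝒪 →ₐ[ℂ] A)

theorem star_comm (a b : Fin N → A) : X.star S a b = X.star S b a := by
  funext α
  rw [star, star, Finset.sum_comm]
  refine Finset.sum_congr rfl fun β _ => Finset.sum_congr rfl fun γ _ => ?_
  rw [X.C_symm]
  ring

theorem star_add (a b c : Fin N → A) : X.star S a (b + c) = X.star S a b + X.star S a c := by
  funext α
  simp only [star, Pi.add_apply, mul_add, Finset.sum_add_distrib]

theorem star_unit (a : Fin N → A) : X.star S (Pi.single 0 1) a = a := by
  funext α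
  rw [star, Finset.sum_eq_single 0]
  · rw [Finset.sum_eq_single α]
    · have h : X.C 0 α α = 1 := (X.unit α α).trans (if_pos rfl)
      simp [h]
    · intro γ _ hγ
      have h : X.C 0 α γ = 0 := (X.unit α γ).trans (if_neg hγ.symm)
      simp [h]
    · simp
  · intro β _ hβ
    simp [hβ]
  · simp

/-- This is the field `assoc` contracted with three vector fields: multiplications by a and by b
commute. -/
theorem star_left_comm (a b c : Fin N → A) :
    X.star S a (X.star S b c) = X.star S b (X.star S a c) := by
  have key : ∀ (a b c : Fin N → A) α, X.star S a (X.star S b c) α =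
      ∑ β, ∑ γ, ∑ δ, S (∑ μ, X.C β α μ * X.C γ μ δ) * (a β * b γ * c δ) := by
    intro a b c α
    rw [star]
    refine Finset.sum_congr rfl fun β _ => ?_
    simp only [star, Finset.mul_sum, map_sum, map_mul, Finset.sum_mul]
    rw [Finset.sum_comm]
    refine Finset.sum_congr rfl fun γ _ => ?_
    rw [Finset.sum_comm]
    exact Finset.sum_congr rfl fun δ _ => Finset.sum_congr rfl fun μ _ => by ring
  funext α
  rw [key, key, Finset.sum_comm]
  refine Finset.sum_congr rfl fun β _ => Finset.sum_congr rfl fun γ _ =>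
    Finset.sum_congr rfl fun δ _ => ?_
  have h : ∑ μ, X.C γ α μ * X.C β μ δ = ∑ μ, X.C β α μ * X.C γ μ δ := X.assoc α γ β δ
  rw [h]
  ring

end star

namespace Calibration

variable {X} (K : X.Calibration)

theorem map_D_Lo_zero (γ : Fin N) : (K.Lo 0).map (𝒜.D γ) = 0 := by
  rw [Lo]
  exact Matrix.map_derivation_one _

/-- `∂Ω^0_d/∂t^γ = C_γ Ω^0_{d-1}`. -/
theorem map_D_Lo_succ (γ : Fin N) (d : ℕ) :
    (K.Lo (d + 1)).map (𝒜.D γ) = X.C γ * K.Lo d := by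
  induction d using Nat.strong_induction_on with
  | _ d ih =>
  -- Differentiate the degree d + 1 part of the inverse relation. The inductive hypothesis and
  -- `deriv_Om` express both halves through the degree d relation multiplied by C_γ, on the left and
  -- on the right. These cancel except for the summand i = d, missing on the left, and the top
  -- derivative.
  have h := congrArg (fun A : Matrix (Fin N) (Fin N) 𝒪 => A.map (𝒜.D γ))
    (K.sum_Lo_mul_Om (d + 1))
  have hmap : ∀ (s : Finset ℕ) (f : ℕ → Matrix (Fin N) (Fin N) 𝒪),
      (∑ i ∈ s, f i).map (𝒜.D γ) = ∑ i ∈ s, (f i).map (𝒜.D γ) := by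
    intro s f
    ext i j
    simp [Matrix.sum_apply]
  have hsm : ∀ (c : ℂ) (f : Matrix (Fin N) (Fin N) 𝒪),
      (c • f).map (𝒜.D γ) = c • f.map (𝒜.D γ) := by
    intro c f
    ext i j
    simp
  have h0 : (0 : Matrix (Fin N) (Fin N) 𝒪).map (𝒜.D γ) = 0 := by ext; simp
  simp only [hmap, hsm, Matrix.map_derivation_mul, Nat.succ_ne_zero, if_false, h0, smul_add,
    Finset.sum_add_distrib] at h
  rw [Finset.sum_range_succ' _ (d + 1), Finset.sum_range_succ (fun i => (-1 : ℂ) ^ i •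
    (K.Lo i * (K.Om (d + 1 - i)).map (𝒜.D γ))) (d + 1)] at h
  rw [Finset.sum_range_succ] at h
  have e1 : ∑ i ∈ Finset.range d, (-1 : ℂ) ^ (i + 1) •
      ((K.Lo (i + 1)).map (𝒜.D γ) * K.Om (d + 1 - (i + 1))) =
      - (X.C γ * ∑ i ∈ Finset.range d, (-1 : ℂ) ^ i • (K.Lo i * K.Om (d - i))) := by
    rw [Finset.mul_sum, ← Finset.sum_neg_distrib]
    refine Finset.sum_congr rfl fun i hi => ?_
    rw [ih i (Finset.mem_range.mp hi), Nat.add_sub_add_right, pow_succ, mul_neg_one, neg_smul,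
      Matrix.mul_smul, Matrix.mul_assoc]
  have e2 : ∑ i ∈ Finset.range (d + 1), (-1 : ℂ) ^ i •
      (K.Lo i * (K.Om (d + 1 - i)).map (𝒜.D γ)) =
      (∑ i ∈ Finset.range (d + 1), (-1 : ℂ) ^ i • (K.Lo i * K.Om (d - i))) * X.C γ := by
    rw [Finset.sum_mul]
    refine Finset.sum_congr rfl fun i hi => ?_
    have : d + 1 - i = d - i + 1 := by
      have := Finset.mem_range.mp hi
      omega
    rw [this, K.deriv_Om, Matrix.smul_mul, Matrix.mul_assoc]
  have e3 := K.sum_Lo_mul_Om d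
  rw [e1, e2, e3, map_D_Lo_zero, Nat.sub_self, K.Om_zero,
    Matrix.map_derivation_one] at h
  rw [Finset.sum_range_succ, Nat.sub_self, K.Om_zero, mul_one] at e3
  rw [← eq_sub_iff_add_eq] at e3
  rw [e3] at h
  have h4 : (-1 : ℂ) ^ (d + 1) • ((K.Lo (d + 1)).map (𝒜.D γ) - X.C γ * K.Lo d) = 0 := by
    rw [← h, mul_one, zero_mul, smul_zero, mul_zero, smul_zero, mul_sub, Matrix.mul_smul, smul_sub,
      pow_succ, mul_neg_one, neg_smul, neg_smul]
    split_ifs <;> simp <;> abel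
  have h5 := (smul_eq_zero_iff_right (by simp)).mp h4
  exact sub_eq_zero.mp h5

/-- The operator of multiplication by the Euler vector field. -/
def eulerMul (X : ConformalFlatFManifold 𝒜) : Matrix (Fin N) (Fin N) 𝒪 := ∑ θ, X.euler θ • X.C θ

/-- The derivative in the homogeneity condition is eliminated by `deriv_Om`. What remains is purely
algebraic, so it survives substitution of v^⊤ and passage to a quotient. -/
theorem Om_mul_eulerMul (e : ℕ) :
    K.Om e * eulerMul X = ((e + 1 : ℕ) : ℂ) • K.Om (e + 1) +
      (K.Om (e + 1) * constMatrix 𝒪 X.Q - constMatrix 𝒪 X.Q * K.Om (e + 1)) +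
      ∑ i ∈ Finset.Icc 1 (e + 1), (-1 : ℂ) ^ (i + 1) •
        (constMatrix 𝒪 (K.R i) * K.Om (e + 1 - i)) := by
  rw [← K.homogeneous (e + 1), eulerMul, Finset.mul_sum]
  refine Finset.sum_congr rfl fun θ _ => ?_
  rw [K.deriv_Om, Matrix.mul_smul]

open MvPowerSeries

variable {v : Fin N → DescRing N 𝒪} (hv : K.IsTopologicalSolution v)

theorem ddtDerivation_shiftedVar (β γ : Fin N) (d q : ℕ) :
    𝒜.ddtDerivation β d (K.shiftedVar γ q) = if γ = β ∧ q = d then 1 else 0 := by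
  have h1 : ∀ (a b : Fin N × ℕ),
      pderiv 𝒪 b (MvPowerSeries.X a : DescRing N 𝒪) = if a = b then 1 else 0 := by
    intro a b
    split_ifs with h
    · rw [h, pderiv_X_self]
    · rw [pderiv_X_of_ne h]
  have h2 : ∀ δ : Derivation ℂ (DescRing N 𝒪) (DescRing N 𝒪), ∀ p : Prop, ∀ [Decidable p],
      δ (if p then 1 else 0) = 0 := by
    intro δ p _
    split_ifs <;> simp
  cases d with
  | zero =>
    cases q with
    | zero =>
      change mapDerivation _ _ (MvPowerSeries.C _) = _
      rw [mapDerivation_C, K.D_flatCoord]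
      split_ifs <;> simp_all
    | succ q =>
      change mapDerivation _ _ (MvPowerSeries.X (γ, q) - _) = _
      rw [map_sub, h2, sub_zero]
      ext n
      classical
      rw [coeff_mapDerivation, coeff_X]
      split_ifs <;> simp_all
  | succ d =>
    cases q with
    | zero =>
      change pderiv 𝒪 (β, d) (MvPowerSeries.C _) = _
      simp
    | succ q =>
      have h3 := h2 (𝒜.ddtDerivation β (d + 1)) (γ = 0 ∧ q = 0)
      have h4 : 𝒜.ddtDerivation β (d + 1) (MvPowerSeries.X (γ, q)) =
          pderiv 𝒪 (β, d) (MvPowerSeries.X (γ, q)) := rfl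
      rw [shiftedVar, map_sub, h3, sub_zero, h4, h1]
      simp

/-- The truncated sum `∑_{q < n} Ω^0_{q-1}|_{t ↦ v} t̃_{q+r}`. -/
def truncSum (n r : ℕ) (α : Fin N) : DescRing N 𝒪 :=
  ∑ q ∈ Finset.range n, ∑ γ, K.substHom hv (K.Lo q α γ) * K.shiftedVar γ (q + r)

/-- The chain rule applied to the hierarchy produces ∂_γ Ω^0_d = C_γ Ω^0_{d-1}, so every flow is v_x
multiplied by a column of the calibration. -/
theorem ddtDerivation_solution (β : Fin N) (d : ℕ) :
    (fun α => 𝒜.ddtDerivation β d (v α)) =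
      X.star (K.substHom hv) (fun α => 𝒜.ddtDerivation 0 0 (v α))
        (fun α => K.substHom hv (K.Lo d α β)) := by
  funext α
  have h := hv.hierarchy α β d
  rw [𝒜.ddt_eq, 𝒜.ddt_eq, ← K.substHom_apply hv, K.ddtDerivation_substHom] at h
  rw [h, star]
  refine Finset.sum_congr rfl fun γ _ => ?_
  have h2 := congrFun (congrFun (K.map_D_Lo_succ γ d) α) β
  rw [Matrix.map_apply] at h2
  rw [h2, Matrix.mul_apply, map_sum, Finset.sum_mul]
  refine Finset.sum_congr rfl fun δ _ => ?_
  rw [map_mul]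
  ring

/-- A derivative falling on a time selects one column of `Lo d`. Falling on `Lo (q + 1)`, it lowers
the index to q, so that the remaining sum pairs `Lo q` with the time q + 1; `Lo 0` is constant. -/
theorem ddtDerivation_truncSum (n : ℕ) (β : Fin N) (d : ℕ) (hd : d ≤ n) :
    (fun α => 𝒜.ddtDerivation β d (K.truncSum hv (n + 1) 0 α)) =
      (fun α => K.substHom hv (K.Lo d α β)) +
      X.star (K.substHom hv) (fun α => 𝒜.ddtDerivation β d (v α)) (K.truncSum hv n 1) := by
  funext α
  simp only [truncSum, map_sum, Derivation.leibniz, smul_eq_mul, K.ddtDerivation_shiftedVar,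
    Finset.sum_add_distrib, Pi.add_apply, add_zero]
  congr 1
  · rw [Finset.sum_eq_single d]
    · rw [Finset.sum_eq_single β]
      · simp
      · intro γ _ hγ
        simp [hγ]
      · simp
    · intro q _ hq
      simp [hq]
    · intro h
      exact absurd (Finset.mem_range.mpr (Nat.lt_succ_of_le hd)) h
  · rw [Finset.sum_range_succ']
    have h0 : ∀ γ, 𝒜.ddtDerivation β d (K.substHom hv (K.Lo 0 α γ)) = 0 := by
      intro γ
      rw [K.ddtDerivation_substHom]
      refine Finset.sum_eq_zero fun δ _ => ?_
      have := congrFun (congrFun (K.map_D_Lo_zero δ) α) γ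
      rw [Matrix.map_apply] at this
      rw [this]
      simp
    simp only [h0, mul_zero, Finset.sum_const_zero, add_zero]
    have h1 : ∀ q γ, 𝒜.ddtDerivation β d (K.substHom hv (K.Lo (q + 1) α γ)) =
        ∑ δ, ∑ ε, K.substHom hv (X.C δ α ε) * 𝒜.ddtDerivation β d (v δ) *
          K.substHom hv (K.Lo q ε γ) := by
      intro q γ
      rw [K.ddtDerivation_substHom]
      refine Finset.sum_congr rfl fun δ _ => ?_
      have := congrFun (congrFun (K.map_D_Lo_succ δ q) α) γ
      rw [Matrix.map_apply] at this
      rw [this, Matrix.mul_apply, map_sum, Finset.sum_mul]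
      exact Finset.sum_congr rfl fun ε _ => by rw [map_mul]; ring
    simp only [h1, star, truncSum, Finset.mul_sum]
    rw [Finset.sum_congr rfl fun q _ => Finset.sum_comm,
      Finset.sum_congr rfl fun q _ => Finset.sum_congr rfl fun δ _ => Finset.sum_comm,
      Finset.sum_comm, Finset.sum_congr rfl fun δ _ => Finset.sum_comm]
    exact Finset.sum_congr rfl fun δ _ => Finset.sum_congr rfl fun ε _ =>
      Finset.sum_congr rfl fun q _ => Finset.sum_congr rfl fun γ _ => by ring

/-- The exponents that involve only the variables `t^*_1, …, t^*_n`. -/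
def lowExponents (N n : ℕ) : LowerSet (Fin N × ℕ →₀ ℕ) where
  carrier := {k | ∀ i, n ≤ i.2 → k i = 0}
  lower' := fun _ _ hba ha i hi => Nat.le_zero.mp ((hba i).trans (ha i hi).le)

/-- The exponents of degree at most `d`. -/
def degreeLE (σ : Type*) (d : ℕ) : LowerSet (σ →₀ ℕ) where
  carrier := {k | k.degree ≤ d}
  lower' := fun _ _ hba ha => (Finsupp.degree_mono hba).trans ha

/-- At t^*_{≥1} = 0 only t̃_0 and the dilaton shift -1 in t̃^1_1 contribute. They give t^α_0 -
Ω^{α,0}_{1,0}, which is zero by the normalization of the flat coordinates; hence at least two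
summands are required. -/
theorem constantCoeff_truncSum (n : ℕ) (α : Fin N) :
    constantCoeff (K.truncSum hv (n + 2) 0 α) = 0 := by
  simp only [truncSum, map_sum, map_mul, K.constantCoeff_substHom]
  rw [Finset.sum_range_succ', Finset.sum_range_succ', Finset.sum_eq_zero, zero_add]
  · simp only [Nat.zero_add, shiftedVar, constantCoeff_C, map_sub, constantCoeff_X]
    rw [Finset.sum_eq_single 0, Finset.sum_eq_single α]
    · simp [Lo, flatCoord]
    · intro b _ hb
      simp [Lo, hb.symm]
    · simp
    · intro b _ hb
      simp [hb]
    · simp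
  · intro q _
    refine Finset.sum_eq_zero fun γ _ => ?_
    simp [shiftedVar]

/-- The Euler–Lagrange equation `∑_q (Ω^⊤)^0_{q-1} t̃_q = 0`. -/
theorem truncSum_mem (n : ℕ) (α : Fin N) :
    K.truncSum hv (n + 2) 0 α ∈ vanishingIdeal 𝒪 (lowExponents N (n + 1)) := by
  set Φ := K.truncSum hv (n + 2) 0 with hΦ
  -- With Ψ the sum of shift one, ∂_xΦ = e + v_x ⋆ Ψ and ∂Φ/∂t^β_d = Ω^0_{d-1} e_β + (v_x ⋆
  -- Ω^0_{d-1} e_β) ⋆ Ψ. By commutativity and associativity the second is the first multiplied by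
  -- Ω^0_{d-1} e_β.
  have hpde : ∀ β d, d ≤ n + 1 → (fun α => 𝒜.ddtDerivation β d (Φ α)) =
      X.star (K.substHom hv) (fun α => 𝒜.ddtDerivation 0 0 (Φ α))
        (fun α => K.substHom hv (K.Lo d α β)) := by
    intro β d hd
    have h0 : (fun α => K.substHom hv (K.Lo 0 α 0)) = Pi.single 0 1 := by
      funext α
      by_cases h : α = 0
      · subst h; simp [Lo]
      · simp [Lo, h]
    rw [hΦ, K.ddtDerivation_truncSum hv _ _ _ hd, K.ddtDerivation_truncSum hv _ _ _ (Nat.zero_le _),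
      h0, X.star_comm _ (_ + _), X.star_add, X.star_comm _ _ (Pi.single 0 1), X.star_unit,
      K.ddtDerivation_solution hv β d, X.star_comm _ _ (K.truncSum hv _ 1),
      X.star_left_comm, X.star_comm _ (fun α => 𝒜.ddtDerivation 0 0 (v α)) (K.truncSum hv _ 1),
      X.star_left_comm _ (fun α => K.substHom hv (K.Lo d α β)),
      X.star_comm _ (fun α => K.substHom hv (K.Lo d α β)),
      X.star_left_comm _ (K.truncSum hv _ 1)]
  -- Since ∂_x acts on the coefficients and preserves degree, the system expresses coefficients of
  -- degree d + 1 through those of degree at most d.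
  have key : ∀ d α, Φ α ∈
      vanishingIdeal 𝒪 (lowExponents N (n + 1) ⊓ degreeLE (Fin N × ℕ) d) := by
    intro d
    induction d with
    | zero =>
      intro α k hk
      obtain rfl : k = 0 := (Finsupp.degree_eq_zero_iff k).mp (Nat.le_zero.mp hk.2)
      exact K.constantCoeff_truncSum hv n α
    | succ d ih =>
      intro α k hk
      by_cases hk0 : k = 0
      · subst hk0
        exact K.constantCoeff_truncSum hv n α
      obtain ⟨l, ⟨β, j⟩, rfl⟩ := FunctionAlgebra.exists_eq_add_single k hk0
      have hj : j < n + 1 := by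
        by_contra hj
        have := hk.1 (β, j) (not_lt.mp hj)
        simp at this
      have hl : l ∈ lowExponents N (n + 1) ⊓ degreeLE (Fin N × ℕ) d := by
        refine ⟨(lowExponents N (n + 1)).lower le_self_add hk.1, ?_⟩
        have h : Finsupp.degree (l + Finsupp.single (β, j) 1) ≤ d + 1 := hk.2
        rw [map_add, Finsupp.degree_single] at h
        exact Nat.le_of_succ_le_succ h
      rw [← map_zero (coeff (R := 𝒪) (l + Finsupp.single (β, j) 1))]
      refine FunctionAlgebra.coeff_succ_eq ?_
      rw [map_zero, map_zero]
      have h := congrFun (hpde β (j + 1) hj) α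
      change pderiv 𝒪 (β, j) (Φ α) = _ at h
      rw [h]
      have hmem : ∀ γ, 𝒜.ddtDerivation 0 0 (Φ γ) ∈
          vanishingIdeal 𝒪 (lowExponents N (n + 1) ⊓ degreeLE (Fin N × ℕ) d) := by
        intro γ k hk
        change 𝒜.D 0 (coeff k (Φ γ)) = 0
        rw [ih γ k hk, map_zero]
      have hstar := Ideal.sum_mem (vanishingIdeal 𝒪 (lowExponents N (n + 1) ⊓
        degreeLE (Fin N × ℕ) d)) (t := Finset.univ) fun γ _ => Ideal.sum_mem _ (t := Finset.univ)
          fun δ _ => Ideal.mul_mem_right (K.substHom hv (K.Lo (j + 1) δ β)) _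
            (Ideal.mul_mem_left _ (K.substHom hv (X.C γ α δ)) (hmem γ))
      exact hstar l hl
  exact fun k hk => key k.degree α k ⟨hk, le_refl k.degree⟩

end Calibration
end ConformalFlatFManifold

end

section

variable {N : ℕ} [NeZero N]

/-! ### Matrices graded by the eigenvalues of `Q` -/

/-- The non-zero entries `A^α_β` have `q^α - q^β ∈ {0, 1, …}`. -/
def NonnegGraded (q : Fin N → ℂ) (A : Matrix (Fin N) (Fin N) ℂ) : Prop :=
  ∀ α β, A α β ≠ 0 → ∃ n : ℕ, q α - q β = n

theorem qPart_apply (q : Fin N → ℂ) (p : ℤ) (A : Matrix (Fin N) (Fin N) ℂ) (α β : Fin N)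
    [Decidable (q α - q β = (p : ℂ))] :
    qPart q p A α β = if q α - q β = (p : ℂ) then A α β else 0 := by
  rw [qPart, Matrix.of_apply]
  congr

theorem NonnegGraded.mul {q : Fin N → ℂ} {A B : Matrix (Fin N) (Fin N) ℂ}
    (hA : NonnegGraded q A) (hB : NonnegGraded q B) : NonnegGraded q (A * B) := by
  intro α β h
  rw [Matrix.mul_apply] at h
  obtain ⟨γ, -, hγ⟩ := Finset.exists_ne_zero_of_sum_ne_zero h
  obtain ⟨a, ha⟩ := hA _ _ (left_ne_zero_of_mul hγ)
  obtain ⟨b, hb⟩ := hB _ _ (right_ne_zero_of_mul hγ)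
  exact ⟨a + b, by push_cast; linear_combination ha + hb⟩

theorem NonnegGraded.add {q : Fin N → ℂ} {A B : Matrix (Fin N) (Fin N) ℂ}
    (hA : NonnegGraded q A) (hB : NonnegGraded q B) : NonnegGraded q (A + B) := by
  intro α β h
  rw [Matrix.add_apply] at h
  by_cases h0 : A α β = 0
  · exact hB _ _ (by simpa [h0] using h)
  · exact hA _ _ h0

theorem NonnegGraded.diagonal (q a : Fin N → ℂ) : NonnegGraded q (Matrix.diagonal a) := by
  intro α β h
  obtain rfl : α = β := by
    by_contra h0
    exact h (Matrix.diagonal_apply_ne _ h0)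
  exact ⟨0, by simp⟩

theorem NonnegGraded.virP {q a : Fin N → ℂ} {R : Matrix (Fin N) (Fin N) ℂ}
    (hR : NonnegGraded q R) (j : ℕ) : NonnegGraded q (virP (Matrix.diagonal a) R j) := by
  induction j with
  | zero =>
    rw [_root_.virP, ← Matrix.diagonal_one]
    exact .diagonal _ _
  | succ j ih =>
    rw [_root_.virP, ← Matrix.diagonal_one, ← Matrix.diagonal_smul, Matrix.diagonal_add]
    exact (hR.mul ih).add (ih.mul (.diagonal _ _))

theorem NonnegGraded.qPart_of_neg {q : Fin N → ℂ} {A : Matrix (Fin N) (Fin N) ℂ}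
    (hA : NonnegGraded q A) {p : ℤ} (hp : p < 0) : qPart q p A = 0 := by
  classical
  ext α β
  rw [qPart_apply, Matrix.zero_apply]
  split_ifs with h
  · by_contra h0
    obtain ⟨n, hn⟩ := hA _ _ h0
    rw [hn] at h
    have : (n : ℤ) = p := by exact_mod_cast h
    omega
  · rfl

/-- The degree q^α - q^β is additive along a product, and non-negativity confines the possible
splittings of n to its antidiagonal. -/
theorem NonnegGraded.qPart_mul {q : Fin N → ℂ} {A B : Matrix (Fin N) (Fin N) ℂ}
    (hA : NonnegGraded q A) (hB : NonnegGraded q B) (n : ℕ) :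
    qPart q n (A * B) =
      ∑ p ∈ Finset.HasAntidiagonal.antidiagonal n, qPart q (p.1 : ℤ) A * qPart q (p.2 : ℤ) B := by
  classical
  ext α β
  rw [qPart_apply, Matrix.sum_apply]
  simp only [Matrix.mul_apply, qPart_apply]
  rw [Finset.sum_comm]
  split_ifs with h
  · refine Finset.sum_congr rfl fun γ _ => ?_
    by_cases h0 : A α γ * B γ β = 0
    · rw [h0]
      refine (Finset.sum_eq_zero fun p _ => ?_).symm
      split_ifs <;> simp [h0]
    · obtain ⟨a, ha⟩ := hA _ _ (left_ne_zero_of_mul h0)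
      obtain ⟨b, hb⟩ := hB _ _ (right_ne_zero_of_mul h0)
      have hab : a + b = n := by
        have : ((a + b : ℕ) : ℂ) = n := by
          push_cast
          rw [← ha, ← hb]
          push_cast at h
          linear_combination h
        exact_mod_cast this
      rw [Finset.sum_eq_single (a, b)]
      · simp [ha, hb]
      · rintro ⟨a', b'⟩ _ hne
        by_cases h1 : a = a'
        · by_cases h2 : b = b'
          · exact absurd (by rw [h1, h2]) hne
          · rw [if_neg (c := q γ - q β = _), mul_zero]
            rw [hb]
            exact_mod_cast h2
        · rw [if_neg, zero_mul]
          rw [ha]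
          exact_mod_cast h1
      · intro hmem
        exact absurd (Finset.HasAntidiagonal.mem_antidiagonal.mpr hab) hmem
  · refine (Finset.sum_eq_zero fun γ _ => Finset.sum_eq_zero fun p hp => ?_).symm
    split_ifs with h1 h2
    · exfalso
      apply h
      rw [← Finset.HasAntidiagonal.mem_antidiagonal.mp hp]
      push_cast at h1 h2 ⊢
      linear_combination h1 + h2
    all_goals simp

/-- On entries of degree n one has q^β = q^α - n, so right multiplication by Q equals left
multiplication by Q - n. In generating series the n becomes z d/dz. -/
theorem qPart_mul_diagonal_add (q : Fin N → ℂ) (c : ℂ) (A : Matrix (Fin N) (Fin N) ℂ) (n : ℕ) :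
    qPart q n (A * (Matrix.diagonal q + c • 1)) =
      (Matrix.diagonal q + c • 1) * qPart q n A - (n : ℂ) • qPart q n A := by
  classical
  rw [← Matrix.diagonal_one, ← Matrix.diagonal_smul, Matrix.diagonal_add]
  ext α β
  rw [qPart_apply, Matrix.sub_apply, Matrix.smul_apply, Matrix.mul_diagonal,
    Matrix.diagonal_mul, qPart_apply]
  split_ifs with h
  · push_cast at h
    simp only [Pi.smul_apply, smul_eq_mul, mul_one]
    linear_combination -(A α β) * h
  · simp

theorem qPart_add (q : Fin N → ℂ) (p : ℤ) (A B : Matrix (Fin N) (Fin N) ℂ) :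
    qPart q p (A + B) = qPart q p A + qPart q p B := by
  classical
  ext α β
  simp only [qPart_apply, Matrix.add_apply]
  split_ifs <;> simp

/-! ### Power series with matrix coefficients -/

section

variable {A : Type} [CommRing A] [Algebra ℂ A]

theorem constMatrix_eq (P : Matrix (Fin N) (Fin N) ℂ) :
    constMatrix A P = (algebraMap ℂ A).mapMatrix P := rfl

theorem constMatrix_smul (c : ℂ) (P : Matrix (Fin N) (Fin N) ℂ) :
    constMatrix A (c • P) = c • constMatrix A P := by
  ext α β
  change algebraMap ℂ A (c * P α β) = c • algebraMap ℂ A (P α β)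
  rw [map_mul, Algebra.smul_def]

/-- The Euler operator `z d/dz`. -/
def eulerOp (f : PowerSeries (Matrix (Fin N) (Fin N) A)) :
    PowerSeries (Matrix (Fin N) (Fin N) A) :=
  PowerSeries.mk fun n => (n : ℂ) • PowerSeries.coeff n f

theorem eulerOp_mul (f g : PowerSeries (Matrix (Fin N) (Fin N) A)) :
    eulerOp (f * g) = eulerOp f * g + f * eulerOp g := by
  ext1 n
  simp only [eulerOp, map_add, PowerSeries.coeff_mk, PowerSeries.coeff_mul, Finset.smul_sum,
    ← Finset.sum_add_distrib]
  refine Finset.sum_congr rfl fun p hp => ?_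
  rw [← Finset.HasAntidiagonal.mem_antidiagonal.mp hp, Nat.cast_add, add_smul, smul_mul_assoc, mul_smul_comm]

theorem eulerOp_C (a : Matrix (Fin N) (Fin N) A) : eulerOp (PowerSeries.C a) = 0 := by
  ext1 n
  rw [eulerOp, PowerSeries.coeff_mk, PowerSeries.coeff_C]
  split_ifs with h <;> simp [h]

theorem eulerOp_sum {ι : Type*} (s : Finset ι) (f : ι → PowerSeries (Matrix (Fin N) (Fin N) A)) :
    eulerOp (∑ i ∈ s, f i) = ∑ i ∈ s, eulerOp (f i) := by
  ext1 n
  simp [eulerOp, Finset.smul_sum]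

/-- A scalar as a constant power series. -/
def scal (c : ℂ) : PowerSeries (Matrix (Fin N) (Fin N) A) :=
  PowerSeries.C (c • (1 : Matrix (Fin N) (Fin N) A))

theorem coeff_scal_mul (c : ℂ) (f : PowerSeries (Matrix (Fin N) (Fin N) A)) (n : ℕ) :
    PowerSeries.coeff n (scal c * f) = c • PowerSeries.coeff n f := by
  rw [scal, PowerSeries.coeff_C_mul, smul_mul_assoc, one_mul]

theorem scal_mul_comm (c : ℂ) (f : PowerSeries (Matrix (Fin N) (Fin N) A)) :
    scal c * f = f * scal c := by
  ext1 n
  rw [scal, PowerSeries.coeff_C_mul, smul_mul_assoc, one_mul, PowerSeries.coeff_mul_C,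
    mul_smul_comm, mul_one]

theorem scal_sub (a b : ℂ) :
    scal (N := N) (A := A) (a - b) = scal a - scal b := by
  rw [scal, scal, scal, sub_smul, map_sub]

theorem eulerOp_X_pow (i : ℕ) :
    eulerOp (PowerSeries.X ^ i : PowerSeries (Matrix (Fin N) (Fin N) A)) =
      scal i * PowerSeries.X ^ i := by
  ext1 n
  rw [eulerOp, PowerSeries.coeff_mk, coeff_scal_mul, PowerSeries.coeff_X_pow]
  split_ifs with h <;> simp [h]

/-- The generating series `∑ [P]_n z^n` of the graded parts of a matrix. -/
def gradedSeries (A : Type) [CommRing A] [Algebra ℂ A] (q : Fin N → ℂ)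
    (P : Matrix (Fin N) (Fin N) ℂ) : PowerSeries (Matrix (Fin N) (Fin N) A) :=
  PowerSeries.mk fun n => constMatrix A (qPart q n P)

theorem coeff_gradedSeries (q : Fin N → ℂ) (P : Matrix (Fin N) (Fin N) ℂ) (n : ℕ) :
    PowerSeries.coeff n (gradedSeries A q P) = constMatrix A (qPart q n P) :=
  PowerSeries.coeff_mk _ _

theorem gradedSeries_one (q : Fin N → ℂ) : gradedSeries A q 1 = 1 := by
  classical
  ext1 n
  rw [coeff_gradedSeries, PowerSeries.coeff_one]
  ext α β
  rw [constMatrix, Matrix.map_apply, qPart_apply]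
  by_cases hn : n = 0
  · subst hn
    by_cases h : α = β
    · subst h; simp
    · simp [h]
  · rw [if_neg hn, Matrix.zero_apply]
    by_cases h : α = β
    · subst h
      rw [sub_self, if_neg, map_zero]
      exact_mod_cast Ne.symm hn
    · simp [h]

/-- The recursion for P multiplies on both sides; after grading it is a single operator acting from
the left, which can then be conjugated. -/
theorem gradedSeries_virP_succ {q : Fin N → ℂ} {R : Matrix (Fin N) (Fin N) ℂ}
    (hR : NonnegGraded q R) (c : ℂ) (j : ℕ) :
    gradedSeries A q (virP (Matrix.diagonal q + c • 1) R (j + 1)) =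
      (PowerSeries.C (constMatrix A (Matrix.diagonal q)) + gradedSeries A q R) *
          gradedSeries A q (virP (Matrix.diagonal q + c • 1) R j) +
        scal (c + j - 1 / 2) * gradedSeries A q (virP (Matrix.diagonal q + c • 1) R j) -
        eulerOp (gradedSeries A q (virP (Matrix.diagonal q + c • 1) R j)) := by
  have hP : NonnegGraded q (virP (Matrix.diagonal q + c • 1) R j) := by
    rw [← Matrix.diagonal_one, ← Matrix.diagonal_smul, Matrix.diagonal_add]
    exact hR.virP j
  ext1 n
  rw [map_sub, map_add, add_mul, map_add, PowerSeries.coeff_C_mul, coeff_scal_mul, eulerOp,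
    PowerSeries.coeff_mk, PowerSeries.coeff_mul]
  simp only [coeff_gradedSeries]
  rw [virP, qPart_add, hR.qPart_mul hP, add_assoc, ← add_smul, qPart_mul_diagonal_add]
  have e : c + ((j : ℂ) - 1 + 1 / 2) = c + j - 1 / 2 := by ring
  simp only [e, ← constMatrix_smul, add_mul, smul_mul_assoc, one_mul]
  simp only [constMatrix_eq, map_add, map_sub, map_sum, map_mul]
  abel

/-! ### The Virasoro operator and its conjugation by the calibration -/

section Conjugation

variable (q : Fin N → ℂ) (R : Matrix (Fin N) (Fin N) ℂ) (U : Matrix (Fin N) (Fin N) A)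

/-- The Virasoro operator `Q + R(z) + c - z d/dz`. -/
def virStep (c : ℂ) (f : PowerSeries (Matrix (Fin N) (Fin N) A)) :
    PowerSeries (Matrix (Fin N) (Fin N) A) :=
  (PowerSeries.C (constMatrix A (Matrix.diagonal q)) + gradedSeries A q R) * f + scal c * f -
    eulerOp f

/-- The Virasoro operator conjugated by the calibration. -/
def conjStep (c : ℂ) (f : PowerSeries (Matrix (Fin N) (Fin N) A)) :
    PowerSeries (Matrix (Fin N) (Fin N) A) :=
  (PowerSeries.C (constMatrix A (Matrix.diagonal q)) + PowerSeries.X * PowerSeries.C U) * f +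
    scal c * f - eulerOp f

theorem virStep_sum {ι : Type*} (c : ℂ) (s : Finset ι)
    (f : ι → PowerSeries (Matrix (Fin N) (Fin N) A)) :
    virStep q R c (∑ i ∈ s, f i) = ∑ i ∈ s, virStep q R c (f i) := by
  simp only [virStep, Finset.mul_sum, eulerOp_sum, Finset.sum_add_distrib,
    Finset.sum_sub_distrib]

variable {q R U}

/-- The hypothesis on S is the differential equation in z that intertwines the two operators; z d/dz
is a derivation and scalars are central, so it extends to products S f. -/
theorem virStep_mul {S : PowerSeries (Matrix (Fin N) (Fin N) A)}
    (hS : (PowerSeries.C (constMatrix A (Matrix.diagonal q)) + gradedSeries A q R) * S - eulerOp S =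
      S * (PowerSeries.C (constMatrix A (Matrix.diagonal q)) + PowerSeries.X * PowerSeries.C U))
    (c : ℂ) (f : PowerSeries (Matrix (Fin N) (Fin N) A)) :
    virStep q R c (S * f) = S * conjStep q U c f := by
  rw [virStep, conjStep, eulerOp_mul, mul_sub, mul_add, ← mul_assoc, ← mul_assoc S, ← hS,
    ← mul_assoc S (scal c), ← scal_mul_comm, sub_mul, mul_assoc (scal c)]
  abel

/-- The factor z^i shifts z d/dz by i. When a decreases by one as i increases by one, c does not
depend on i, so one operator advances all summands at once. -/
theorem virStep_monomial (hR : NonnegGraded q R) (a c : ℂ) (i j : ℕ)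
    (g : Matrix (Fin N) (Fin N) A) (hc : c = a + i + j - 1 / 2) :
    virStep q R c (PowerSeries.X ^ i *
        (gradedSeries A q (virP (Matrix.diagonal q + a • 1) R j) * PowerSeries.C g)) =
      PowerSeries.X ^ i * (gradedSeries A q (virP (Matrix.diagonal q + a • 1) R (j + 1)) *
        PowerSeries.C g) := by
  have hc' : a + j - 1 / 2 = c - i := by rw [hc]; ring
  rw [gradedSeries_virP_succ hR, hc', scal_sub, virStep, eulerOp_mul, eulerOp_X_pow, eulerOp_mul,
    eulerOp_C]
  set P := gradedSeries A q (virP (Matrix.diagonal q + a • 1) R j)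
  set V := PowerSeries.C (constMatrix A (Matrix.diagonal q)) + gradedSeries A q R
  have hX : ∀ f : PowerSeries (Matrix (Fin N) (Fin N) A),
      f * PowerSeries.X ^ i = PowerSeries.X ^ i * f := fun f =>
    (PowerSeries.commute_X_pow f i).eq
  rw [← mul_assoc V, ← mul_assoc (scal c), hX, hX, hX]
  simp only [mul_add, add_mul, sub_mul, mul_sub, mul_assoc, mul_zero, add_zero]
  abel

/-- The conjugated operator contains z only through zU, so a degree bound grows by at most one. -/
theorem coeff_conjStep_succ (c : ℂ) (f : PowerSeries (Matrix (Fin N) (Fin N) A)) (n : ℕ)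
    (h1 : PowerSeries.coeff n f = 0) (h2 : PowerSeries.coeff (n + 1) f = 0) :
    PowerSeries.coeff (n + 1) (conjStep q U c f) = 0 := by
  rw [conjStep, map_sub, map_add, add_mul, map_add, PowerSeries.coeff_C_mul, mul_assoc,
    PowerSeries.coeff_succ_X_mul, PowerSeries.coeff_C_mul, coeff_scal_mul, eulerOp,
    PowerSeries.coeff_mk, h1, h2]
  simp

end Conjugation

/-! ### Generating series of the calibration and vanishing of the top coefficient -/

theorem PowerSeries.eq_zero_of_mul_eq_zero_of_coeff_zero {B : Type*} [Ring B] {T E : PowerSeries B}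
    (hT : PowerSeries.coeff 0 T = 1) (h : T * E = 0) : E = 0 := by
  ext n
  induction n using Nat.strong_induction_on with
  | _ n ih =>
  have hn := congrArg (PowerSeries.coeff n) h
  rw [PowerSeries.coeff_mul, Finset.sum_eq_single (0, n)] at hn
  · simpa only [hT, one_mul] using hn
  · rintro ⟨a, b⟩ hab hne
    rw [Finset.HasAntidiagonal.mem_antidiagonal] at hab
    have hb : b < n := by
      refine lt_of_le_of_ne (by simp only at hab; omega) fun hbn => hne ?_
      simp only at hab
      rw [Prod.mk.injEq]
      omega
    rw [ih b hb, map_zero, mul_zero]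
  · intro hmem
    exact absurd (Finset.HasAntidiagonal.mem_antidiagonal.mpr (zero_add n)) hmem

/-- The coefficients are matrices, so that a right inverse is two-sided needs an argument: a factor
with constant term 1 is left cancellable. -/
theorem PowerSeries.mul_eq_one_symm_of_coeff_zero {B : Type*} [Ring B] {T S : PowerSeries B}
    (hT : PowerSeries.coeff 0 T = 1) (h : T * S = 1) : S * T = 1 := by
  refine sub_eq_zero.mp (PowerSeries.eq_zero_of_mul_eq_zero_of_coeff_zero hT ?_)
  rw [mul_sub, ← mul_assoc, h, one_mul, mul_one, sub_self]

/-- The series `∑ (-1)^e Ω^{e-1}_0 z^e`. -/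
def altSeries (Om : ℕ → Matrix (Fin N) (Fin N) A) : PowerSeries (Matrix (Fin N) (Fin N) A) :=
  PowerSeries.mk fun e => (-1 : ℂ) ^ e • Om e

theorem mk_mul_altSeries {Om Lo : ℕ → Matrix (Fin N) (Fin N) A}
    (h : ∀ e, ∑ i ∈ Finset.range (e + 1), (-1 : ℂ) ^ i • (Lo i * Om (e - i)) =
      if e = 0 then 1 else 0) :
    PowerSeries.mk Lo * altSeries Om = 1 := by
  ext1 e
  rw [PowerSeries.coeff_mul, PowerSeries.coeff_one]
  have h2 : (if e = 0 then (1 : Matrix (Fin N) (Fin N) A) else 0) =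
      (-1 : ℂ) ^ e • if e = 0 then 1 else 0 := by
    split_ifs with h <;> simp [h]
  rw [h2, ← h, Finset.Nat.sum_antidiagonal_eq_sum_range_succ_mk, Finset.smul_sum]
  refine Finset.sum_congr rfl fun i hi => ?_
  have hi' : i ≤ e := Nat.lt_succ_iff.mp (Finset.mem_range.mp hi)
  rw [altSeries, PowerSeries.coeff_mk, PowerSeries.coeff_mk, mul_smul_comm, smul_smul]
  congr 1
  obtain ⟨k, rfl⟩ := Nat.exists_eq_add_of_le hi'
  rw [Nat.add_sub_cancel_left, pow_add, mul_right_comm, ← pow_add, ← two_mul, pow_mul]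
  simp

/-- The coefficient of z^{e+1} is the homogeneity relation up to the sign (-1)^e. The coefficient of
z^0 only requires that R have no part of degree zero. -/
theorem altSeries_conj {q : Fin N → ℂ} {R : Matrix (Fin N) (Fin N) ℂ}
    {U : Matrix (Fin N) (Fin N) A} {Om : ℕ → Matrix (Fin N) (Fin N) A} (h0 : Om 0 = 1)
    (hR0 : qPart q 0 R = 0)
    (h : ∀ e, Om e * U = ((e + 1 : ℕ) : ℂ) • Om (e + 1) +
      (Om (e + 1) * constMatrix A (Matrix.diagonal q) -
        constMatrix A (Matrix.diagonal q) * Om (e + 1)) +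
      ∑ i ∈ Finset.Icc 1 (e + 1), (-1 : ℂ) ^ (i + 1) •
        (constMatrix A (qPart q i R) * Om (e + 1 - i))) :
    (PowerSeries.C (constMatrix A (Matrix.diagonal q)) + gradedSeries A q R) * altSeries Om -
        eulerOp (altSeries Om) =
      altSeries Om *
        (PowerSeries.C (constMatrix A (Matrix.diagonal q)) + PowerSeries.X * PowerSeries.C U) := by
  have hc0 : constMatrix A (0 : Matrix (Fin N) (Fin N) ℂ) = 0 := by
    rw [constMatrix_eq, map_zero]
  ext1 n
  rw [map_sub, add_mul, map_add, mul_add, map_add, PowerSeries.coeff_C_mul,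
    PowerSeries.coeff_mul_C, ← mul_assoc, PowerSeries.coeff_mul_C, PowerSeries.coeff_mul, eulerOp,
    PowerSeries.coeff_mk, Finset.Nat.sum_antidiagonal_eq_sum_range_succ_mk]
  cases n with
  | zero =>
    simp [altSeries, h0, coeff_gradedSeries, hR0, hc0]
  | succ e =>
    rw [PowerSeries.coeff_succ_mul_X]
    simp only [altSeries, PowerSeries.coeff_mk, coeff_gradedSeries, smul_mul_assoc, h]
    rw [Finset.sum_range_succ', Nat.cast_zero, hR0, hc0, zero_mul, add_zero]
    have hs : ∑ i ∈ Finset.Icc 1 (e + 1), (-1 : ℂ) ^ (i + 1) •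
        (constMatrix A (qPart q i R) * Om (e + 1 - i)) =
        (-1 : ℂ) ^ e • ∑ k ∈ Finset.range (e + 1), constMatrix A (qPart q (k + 1 : ℕ) R) *
          (-1 : ℂ) ^ (e + 1 - (k + 1)) • Om (e + 1 - (k + 1)) := by
      rw [Finset.range_eq_Ico, Finset.sum_Ico_add' (fun i : ℕ => constMatrix A (qPart q i R) *
        (-1 : ℂ) ^ (e + 1 - i) • Om (e + 1 - i)) 0 (e + 1) 1, Finset.smul_sum]
      refine Finset.sum_congr (by ext; simp) fun i hi => ?_
      have hi' : i ≤ e + 1 := by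
        have := Finset.mem_Icc.mp hi
        omega
      rw [mul_smul_comm, smul_smul]
      congr 1
      obtain ⟨k, hk⟩ := Nat.exists_eq_add_of_le hi'
      rw [hk, Nat.add_sub_cancel_left]
      have hk2 : (-1 : ℂ) ^ (e + 1) = (-1) ^ i * (-1) ^ k := by rw [hk, pow_add]
      have h3 : (-1 : ℂ) ^ k * (-1) ^ k = 1 := by
        rw [← mul_pow]; simp
      rw [pow_succ] at hk2
      rw [pow_succ]
      linear_combination (-1 : ℂ) ^ k * hk2 + (-1) ^ i * h3
    have h4 : (-1 : ℂ) ^ e * (-1) ^ e = 1 := by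
      rw [← mul_pow]; simp
    rw [hs, smul_add, smul_smul ((-1 : ℂ) ^ e) ((-1 : ℂ) ^ e), h4, one_smul, pow_succ]
    simp only [neg_smul, mul_one, smul_add, smul_sub, smul_neg, mul_neg, mul_smul_comm,
      smul_smul]
    rw [mul_comm ((-1 : ℂ) ^ e)]
    abel

/-- The vanishing of the Virasoro expression, for generating series. -/
theorem sum_virP_mul_eq_zero {q : Fin N → ℂ} {R : Matrix (Fin N) (Fin N) ℂ}
    {U : Matrix (Fin N) (Fin N) A} {S T H : PowerSeries (Matrix (Fin N) (Fin N) A)}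
    (hR : NonnegGraded q R) (hTS : T * S = 1)
    (hS : (PowerSeries.C (constMatrix A (Matrix.diagonal q)) + gradedSeries A q R) * S - eulerOp S =
      S * (PowerSeries.C (constMatrix A (Matrix.diagonal q)) + PowerSeries.X * PowerSeries.C U))
    (hT : PowerSeries.coeff 0 T = 1) (D : ℕ) (hH : ∀ s, D ≤ s → PowerSeries.coeff s H = 0) (lam : ℂ) (j : ℕ) :
    ∑ p ∈ Finset.HasAntidiagonal.antidiagonal (D + j), ∑ i ∈ Finset.range (p.2 + 1),
      PowerSeries.coeff p.1 T * (constMatrix A (qPart q ((p.2 - i : ℕ) : ℤ)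
        (virP (Matrix.diagonal q + (lam - 3 / 2 - ((i : ℂ) - D - 1)) • 1) R j)) *
          PowerSeries.coeff i (S * H)) = 0 := by
  have hST := PowerSeries.mul_eq_one_symm_of_coeff_zero hT hTS
  -- Only coefficients up to z^L enter the claim, so the sums over i stop at L; the resulting G
  -- agrees with the untruncated series up to that degree and no further.
  set L := D + j with hL
  set G : ℕ → PowerSeries (Matrix (Fin N) (Fin N) A) := fun k =>
    ∑ i ∈ Finset.range (L + 1), PowerSeries.X ^ i *
      (gradedSeries A q (virP (Matrix.diagonal q + (lam - 3 / 2 - ((i : ℂ) - D - 1)) • 1) R k) *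
        PowerSeries.C (PowerSeries.coeff i (S * H))) with hG
  have hstep : ∀ k, G (k + 1) = virStep q R (D + k + lam - 1) (G k) := by
    intro k
    rw [hG, virStep_sum]
    -- Here a = λ - 3/2 - (i - D - 1), so a + i + k - 1/2 = D + k + λ - 1 has lost its dependence on
    -- i.
    refine Finset.sum_congr rfl fun i _ => (virStep_monomial hR _ _ _ _ _ ?_).symm
    ring
  have hTstep : ∀ k, T * G (k + 1) = conjStep q U (D + k + lam - 1) (T * G k) := by
    intro k
    have h1 : G k = S * (T * G k) := by rw [← mul_assoc, hST, one_mul]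
    rw [hstep, h1, virStep_mul hS, ← mul_assoc T, hTS, one_mul, ← h1]
  have hG0 : ∀ s ≤ L, PowerSeries.coeff s (G 0) = PowerSeries.coeff s (S * H) := by
    intro s hs
    rw [hG, map_sum, Finset.sum_eq_single s]
    · simp [virP, gradedSeries_one]
    · intro i _ hi
      rw [virP, gradedSeries_one, one_mul, PowerSeries.coeff_X_pow_mul']
      split_ifs with h
      · rw [PowerSeries.coeff_C, if_neg (by omega)]
      · rfl
    · intro h
      exact absurd (Finset.mem_range.mpr (Nat.lt_succ_of_le hs)) h
  -- Initially T G_0 agrees with H, which vanishes from degree D on; each step costs one degree.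
  have hvan : ∀ k s, D + k ≤ s → s ≤ L → PowerSeries.coeff s (T * G k) = 0 := by
    intro k
    induction k with
    | zero =>
      intro s hs hsL
      rw [← hH s hs, ← one_mul H, ← hTS, mul_assoc, PowerSeries.coeff_mul, PowerSeries.coeff_mul]
      refine Finset.sum_congr rfl fun p hp => ?_
      rw [hG0]
      have := Finset.HasAntidiagonal.mem_antidiagonal.mp hp
      omega
    | succ k ih =>
      intro s hs hsL
      obtain ⟨n, rfl⟩ : ∃ n, s = n + 1 := ⟨s - 1, by omega⟩
      rw [hTstep]
      exact coeff_conjStep_succ _ _ _ (ih n (by omega) (by omega)) (ih _ (by omega) hsL)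
  have hfin := hvan j L le_rfl le_rfl
  rw [PowerSeries.coeff_mul] at hfin
  rw [← hfin]
  refine Finset.sum_congr rfl fun p hp => ?_
  have hp2 : p.2 ≤ L := by
    have := Finset.HasAntidiagonal.mem_antidiagonal.mp hp
    omega
  rw [← Finset.mul_sum, hG, map_sum]
  congr 1
  rw [← Finset.sum_subset (Finset.range_mono (Nat.succ_le_succ hp2))]
  · refine Finset.sum_congr rfl fun i hi => ?_
    have hi' : i ≤ p.2 := Nat.lt_succ_iff.mp (Finset.mem_range.mp hi)
    rw [PowerSeries.coeff_X_pow_mul', if_pos hi', PowerSeries.coeff_mul_C, coeff_gradedSeries]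
  · intro i _ hi
    rw [PowerSeries.coeff_X_pow_mul', if_neg]
    intro h
    exact hi (Finset.mem_range.mpr (Nat.lt_succ_of_le h))

end

end

/-! ### Reduction modulo high times and identification of the Virasoro expression -/

section

variable {N : ℕ} [NeZero N] {𝒪 : Type} [CommRing 𝒪] [Algebra ℂ 𝒪]

open MvPowerSeries in
theorem formalSum_sub_sum_mem {ι : Type} {f : ι → DescRing N 𝒪}
    {U : LowerSet (Fin N × ℕ →₀ ℕ)} (s : Finset ι)
    (hs : ∀ i ∉ s, f i ∈ vanishingIdeal 𝒪 U) :
    formalSum f - ∑ i ∈ s, f i ∈ vanishingIdeal 𝒪 U := by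
  intro n hn
  have h : coeff n (formalSum f) = ∑ᶠ i, coeff n (f i) := rfl
  rw [map_sub, map_sum, h, finsum_eq_sum_of_support_subset, sub_self]
  intro i hi
  by_contra his
  exact hi (hs i his n hn)

namespace ConformalFlatFManifold.Calibration

variable {𝒜 : FunctionAlgebra N 𝒪} {X : ConformalFlatFManifold 𝒜} (K : X.Calibration)

theorem R_apply_eq_zero {n : ℕ} (hn : 1 ≤ n) {α β : Fin N} (h : X.q α - X.q β ≠ n) :
    K.R n α β = 0 := by
  have h1 := congrFun (congrFun (K.comm_R n hn) α) β
  simp only [ConformalFlatFManifold.Q, Matrix.sub_apply, Matrix.diagonal_mul,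
    Matrix.mul_diagonal, Matrix.smul_apply, smul_eq_mul] at h1
  have h2 : (X.q α - X.q β - n) * K.R n α β = 0 := by linear_combination h1
  exact (mul_eq_zero.mp h2).resolve_left (sub_ne_zero.mpr h)

theorem Rtot_eq_sum : K.Rtot = ∑ n ∈ K.finite_R.toFinset, K.R n := by
  have h : (fun n : ℕ => ∑ᶠ _ : 1 ≤ n, K.R n) = fun n => if 1 ≤ n then K.R n else 0 :=
    funext fun n => finsum_eq_if
  rw [Rtot, h, finsum_eq_sum_of_support_subset (s := K.finite_R.toFinset)]
  · refine Finset.sum_congr rfl fun n hn => if_pos ?_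
    exact ((Set.Finite.mem_toFinset _).mp hn).1
  · intro n hn
    rw [Set.Finite.coe_toFinset]
    by_cases h1 : 1 ≤ n
    · exact ⟨h1, by simpa [h1] using hn⟩
    · simp [h1] at hn

/-- The relation [Q, R_n] = n R_n places R_n entirely in degree n, so the graded parts of the sum
recover its summands. -/
theorem qPart_Rtot {n : ℕ} (hn : 1 ≤ n) : qPart X.q n K.Rtot = K.R n := by
  classical
  ext α β
  rw [qPart_apply, Rtot_eq_sum, Matrix.sum_apply]
  split_ifs with h
  · rw [Finset.sum_eq_single n]
    · intro k hk hkn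
      refine K.R_apply_eq_zero ((Set.Finite.mem_toFinset _).mp hk).1 ?_
      rw [h]
      exact_mod_cast hkn.symm
    · intro hmem
      rw [Set.Finite.mem_toFinset] at hmem
      by_contra h0
      exact hmem ⟨hn, fun h1 => h0 (by rw [h1]; rfl)⟩
  · exact (K.R_apply_eq_zero hn (by exact_mod_cast h)).symm

theorem exists_of_Rtot_apply_ne_zero {α β : Fin N} (h : K.Rtot α β ≠ 0) :
    ∃ n : ℕ, 1 ≤ n ∧ X.q α - X.q β = n := by
  rw [Rtot_eq_sum, Matrix.sum_apply] at h
  obtain ⟨n, hn, hne⟩ := Finset.exists_ne_zero_of_sum_ne_zero h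
  have hn1 := ((Set.Finite.mem_toFinset _).mp hn).1
  refine ⟨n, hn1, ?_⟩
  by_contra h1
  exact hne (K.R_apply_eq_zero hn1 h1)

theorem nonnegGraded_Rtot : NonnegGraded X.q K.Rtot := fun _ _ h =>
  let ⟨n, _, hn⟩ := K.exists_of_Rtot_apply_ne_zero h
  ⟨n, hn⟩

theorem qPart_zero_Rtot : qPart X.q 0 K.Rtot = 0 := by
  classical
  ext α β
  rw [qPart_apply, Matrix.zero_apply]
  split_ifs with h
  · by_contra h0
    obtain ⟨n, hn1, hn⟩ := K.exists_of_Rtot_apply_ne_zero h0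
    rw [hn] at h
    have : n = 0 := by exact_mod_cast h
    omega
  · rfl

open MvPowerSeries

/-- The quotient of `𝒪(M)[[t^*_{≥1}]]` by the variables `t^*_d`, `d > D`. -/
def ReducedRing (N : ℕ) (𝒪 : Type) [CommRing 𝒪] (D : ℕ) : Type :=
  DescRing N 𝒪 ⧸ vanishingIdeal 𝒪 (lowExponents N D)

instance (D : ℕ) : CommRing (ReducedRing N 𝒪 D) :=
  inferInstanceAs (CommRing (DescRing N 𝒪 ⧸ vanishingIdeal 𝒪 (lowExponents N D)))

instance (D : ℕ) : Algebra ℂ (ReducedRing N 𝒪 D) :=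
  inferInstanceAs (Algebra ℂ (DescRing N 𝒪 ⧸ vanishingIdeal 𝒪 (lowExponents N D)))

/-- Reduction modulo the variables `t^*_d`, `d > D`. -/
def reduction (N : ℕ) (𝒪 : Type) [CommRing 𝒪] [Algebra ℂ 𝒪] (D : ℕ) :
    DescRing N 𝒪 →ₐ[ℂ] ReducedRing N 𝒪 D :=
  Ideal.Quotient.mkₐ ℂ (vanishingIdeal 𝒪 (lowExponents N D))

theorem reduction_eq_zero {D : ℕ} {f : DescRing N 𝒪} :
    reduction N 𝒪 D f = 0 ↔ f ∈ vanishingIdeal 𝒪 (lowExponents N D) :=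
  Ideal.Quotient.eq_zero_iff_mem

theorem reduction_formalSum {ι : Type} {f : ι → DescRing N 𝒪} {D : ℕ} (s : Finset ι)
    (hs : ∀ i ∉ s, f i ∈ vanishingIdeal 𝒪 (lowExponents N D)) :
    reduction N 𝒪 D (formalSum f) = ∑ i ∈ s, reduction N 𝒪 D (f i) := by
  rw [← sub_eq_zero, ← map_sum, ← map_sub, reduction_eq_zero]
  exact formalSum_sub_sum_mem s hs

theorem shiftedVar_mem {D : ℕ} (hD : 1 ≤ D) (γ : Fin N) {q : ℕ} (hq : D < q) :
    K.shiftedVar γ q ∈ vanishingIdeal 𝒪 (lowExponents N D) := by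
  classical
  obtain ⟨k, rfl⟩ : ∃ k, q = k + 1 := ⟨q - 1, by omega⟩
  have hk : k ≠ 0 := by omega
  intro n hn
  simp only [shiftedVar, hk, and_false, if_false, sub_zero]
  rw [coeff_X, if_neg]
  rintro rfl
  have := hn (γ, k) (by change D ≤ k; omega)
  simp at this

variable {v : Fin N → DescRing N 𝒪} (hv : K.IsTopologicalSolution v)

theorem reduction_potential_nonneg {D : ℕ} (hD : 1 ≤ D) (α : Fin N) (p : ℕ) :
    reduction N 𝒪 D (K.potential v α (p : ℤ)) =
      ∑ q ∈ Finset.range (D + 1), ∑ γ, reduction N 𝒪 D (K.substHom hv (K.Omega p q α γ)) *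
        reduction N 𝒪 D (K.shiftedVar γ q) := by
  change reduction N 𝒪 D (formalSum (K.potentialTerm v α p)) = _
  rw [reduction_formalSum (Finset.univ ×ˢ Finset.range (D + 1)), Finset.sum_product_right]
  · refine Finset.sum_congr rfl fun q _ => Finset.sum_congr rfl fun γ _ => ?_
    rw [potentialTerm, map_mul, substHom_apply]
  · rintro ⟨γ, q⟩ h
    refine Ideal.mul_mem_left _ _ (K.shiftedVar_mem hD γ ?_)
    simp only [Finset.mem_product, Finset.mem_univ, Finset.mem_range, true_and] at h
    change D < q
    omega

/-- The calibration along the topological solution, modulo the variables `t^*_d`, `d > D`. -/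
def reducedMatrix (D : ℕ) : Matrix (Fin N) (Fin N) 𝒪 →ₐ[ℂ]
    Matrix (Fin N) (Fin N) (ReducedRing N 𝒪 D) :=
  ((reduction N 𝒪 D).comp (K.substHom hv)).mapMatrix

theorem reducedMatrix_apply (D : ℕ) (P : Matrix (Fin N) (Fin N) 𝒪) (α β : Fin N) :
    K.reducedMatrix hv D P α β = reduction N 𝒪 D (K.substHom hv (P α β)) := rfl

theorem reducedMatrix_constMatrix (D : ℕ) (P : Matrix (Fin N) (Fin N) ℂ) :
    K.reducedMatrix hv D (constMatrix 𝒪 P) = constMatrix _ P := by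
  ext α β
  exact AlgHom.commutes ((reduction N 𝒪 D).comp (K.substHom hv)) (P α β)

/-- The reduction of the shifted variables, as a matrix with equal columns. -/
def reducedVar (D q : ℕ) :
    Matrix (Fin N) (Fin N) (ReducedRing N 𝒪 D) :=
  Matrix.of fun α _ => reduction N 𝒪 D (K.shiftedVar α q)

/-- The series `∑_k u_k z^{D-k}`, `u_k = ∑_q Ω^0_{q-1} t̃_{q+k}`. -/
def reducedSeries (D : ℕ) : PowerSeries
    (Matrix (Fin N) (Fin N) (ReducedRing N 𝒪 D)) :=
  PowerSeries.mk fun s => if s ≤ D then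
    ∑ r ∈ Finset.range (s + 1), K.reducedMatrix hv D (K.Lo r) * K.reducedVar D (r + (D - s)) else 0

/-- The coefficient of z^D is the Euler–Lagrange expression; beyond z^D the series is cut off by
definition. -/
theorem coeff_reducedSeries_eq_zero (n s : ℕ) (hs : n + 1 ≤ s) :
    PowerSeries.coeff s (K.reducedSeries hv (n + 1)) = 0 := by
  rw [reducedSeries, PowerSeries.coeff_mk]
  split_ifs with h
  · obtain rfl : s = n + 1 := le_antisymm h hs
    ext α β
    rw [Matrix.sum_apply, Matrix.zero_apply, ← (reduction_eq_zero.mpr (K.truncSum_mem hv n α)),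
      truncSum, map_sum]
    refine Finset.sum_congr rfl fun r _ => ?_
    rw [Matrix.mul_apply, map_sum]
    refine Finset.sum_congr rfl fun γ _ => ?_
    rw [map_mul, reducedMatrix_apply, reducedVar, Matrix.of_apply, Nat.sub_self]
  · rfl

theorem reduced_Lo_mul_Om (D : ℕ) :
    PowerSeries.mk (fun e => K.reducedMatrix hv D (K.Lo e)) *
      altSeries (fun e => K.reducedMatrix hv D (K.Om e)) = 1 := by
  refine mk_mul_altSeries fun e => ?_
  have h := congrArg (K.reducedMatrix hv D) (K.sum_Lo_mul_Om e)
  rw [map_sum] at h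
  simp only [map_smul, map_mul] at h
  rw [h]
  split_ifs <;> simp

theorem coeff_zero_reduced_Lo (D : ℕ) :
    PowerSeries.coeff 0 (PowerSeries.mk fun e => K.reducedMatrix hv D (K.Lo e)) = 1 := by
  rw [PowerSeries.coeff_mk, Lo, map_one]

theorem reduced_conj (D : ℕ) :
    (PowerSeries.C (constMatrix _ (Matrix.diagonal X.q)) + gradedSeries _ X.q K.Rtot) *
        altSeries (fun e => K.reducedMatrix hv D (K.Om e)) -
      eulerOp (altSeries (fun e => K.reducedMatrix hv D (K.Om e))) =
      altSeries (fun e => K.reducedMatrix hv D (K.Om e)) *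
        (PowerSeries.C (constMatrix _ (Matrix.diagonal X.q)) +
          PowerSeries.X * PowerSeries.C (K.reducedMatrix hv D (eulerMul X))) := by
  refine altSeries_conj (by rw [K.Om_zero, map_one]) K.qPart_zero_Rtot fun e => ?_
  have h := congrArg (K.reducedMatrix hv D) (K.Om_mul_eulerMul e)
  rw [map_mul] at h
  rw [h, map_add, map_add, map_sub, map_smul, map_mul, map_mul, map_sum]
  rw [show X.Q = Matrix.diagonal X.q from rfl, reducedMatrix_constMatrix]
  congr 1
  refine Finset.sum_congr rfl fun i hi => ?_
  rw [map_smul, map_mul, reducedMatrix_constMatrix, K.qPart_Rtot (Finset.mem_Icc.mp hi).1]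

/-- Up to degree D the series H agrees with T Y, where Y is the series of reversed times, and S
undoes T. -/
theorem coeff_altSeries_mul_reducedSeries_low {D i : ℕ} (hi : i ≤ D) :
    PowerSeries.coeff i (altSeries (fun e => K.reducedMatrix hv D (K.Om e)) *
      K.reducedSeries hv D) = K.reducedVar D (D - i) := by
  set Y : PowerSeries (Matrix (Fin N) (Fin N)
    (ReducedRing N 𝒪 D)) :=
    PowerSeries.mk fun s => K.reducedVar D (D - s) with hY
  have hH : ∀ s ≤ D, PowerSeries.coeff s (K.reducedSeries hv D) = PowerSeries.coeff s
      (PowerSeries.mk (fun e => K.reducedMatrix hv D (K.Lo e)) * Y) := by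
    intro s hs
    rw [reducedSeries, PowerSeries.coeff_mk, if_pos hs, PowerSeries.coeff_mul,
      Finset.Nat.sum_antidiagonal_eq_sum_range_succ_mk]
    refine Finset.sum_congr rfl fun r hr => ?_
    have : r ≤ s := Nat.lt_succ_iff.mp (Finset.mem_range.mp hr)
    rw [PowerSeries.coeff_mk, hY, PowerSeries.coeff_mk]
    congr 2
    omega
  have h : PowerSeries.coeff i (altSeries (fun e => K.reducedMatrix hv D (K.Om e)) *
      K.reducedSeries hv D) = PowerSeries.coeff i
        (altSeries (fun e => K.reducedMatrix hv D (K.Om e)) *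
          (PowerSeries.mk (fun e => K.reducedMatrix hv D (K.Lo e)) * Y)) := by
    rw [PowerSeries.coeff_mul, PowerSeries.coeff_mul]
    refine Finset.sum_congr rfl fun p hp => ?_
    rw [hH]
    have := Finset.HasAntidiagonal.mem_antidiagonal.mp hp
    omega
  rw [h, ← mul_assoc, PowerSeries.mul_eq_one_symm_of_coeff_zero (K.coeff_zero_reduced_Lo hv D)
    (K.reduced_Lo_mul_Om hv D), one_mul, hY, PowerSeries.coeff_mk]

/-- Above degree D the cut-off of H removes part of the cancellation between S and T; the partial
sums left over are exactly those that define Ω^p_q. -/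
theorem coeff_altSeries_mul_reducedSeries_high (D p : ℕ) :
    PowerSeries.coeff (D + 1 + p) (altSeries (fun e => K.reducedMatrix hv D (K.Om e)) *
      K.reducedSeries hv D) = (-1 : ℂ) ^ (p + 1) • ∑ q ∈ Finset.range (D + 1),
        K.reducedMatrix hv D (K.Omega p q) * K.reducedVar D q := by
  rw [PowerSeries.coeff_mul, ← Finset.Nat.sum_antidiagonal_swap,
    Finset.Nat.sum_antidiagonal_eq_sum_range_succ_mk]
  rw [← Finset.sum_subset (Finset.range_mono (show D + 1 ≤ (D + 1 + p).succ by omega))]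
  swap
  · intro s _ hs
    rw [Finset.mem_range, not_lt] at hs
    rw [Prod.fst_swap, Prod.snd_swap, reducedSeries, PowerSeries.coeff_mk, if_neg (by omega),
      mul_zero]
  simp only [Omega, map_sum, Finset.sum_mul, Finset.smul_sum]
  have h1 : ∀ s ∈ Finset.range (D + 1),
      PowerSeries.coeff (s, D + 1 + p - s).swap.1
        (altSeries fun e => K.reducedMatrix hv D (K.Om e)) *
      PowerSeries.coeff (s, D + 1 + p - s).swap.2 (K.reducedSeries hv D) =
      ∑ r ∈ Finset.range (s + 1), (-1 : ℂ) ^ (D + 1 + p - s) •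
        (K.reducedMatrix hv D (K.Om (D + 1 + p - s)) * K.reducedMatrix hv D (K.Lo r) *
          K.reducedVar D (r + (D - s))) := by
    intro s hs
    rw [Prod.fst_swap, Prod.snd_swap, reducedSeries, PowerSeries.coeff_mk,
      if_pos (Nat.lt_succ_iff.mp (Finset.mem_range.mp hs)), altSeries, PowerSeries.coeff_mk,
      Finset.mul_sum]
    refine Finset.sum_congr rfl fun r _ => ?_
    rw [smul_mul_assoc, mul_assoc]
  rw [Finset.sum_congr rfl h1, Finset.sum_sigma', Finset.sum_sigma']
  -- The time index is q = r + (D - s), so that q - r = D - s matches the exponent and indices in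
  -- `Omega p q`.
  refine Finset.sum_nbij' (fun x => ⟨x.2 + (D - x.1), x.2⟩) (fun x => ⟨D - (x.1 - x.2), x.2⟩)
    ?_ ?_ ?_ ?_ ?_
  · rintro ⟨s, r⟩ h
    simp only [Finset.mem_sigma, Finset.mem_range] at h ⊢
    omega
  · rintro ⟨s, r⟩ h
    simp only [Finset.mem_sigma, Finset.mem_range] at h ⊢
    omega
  · rintro ⟨s, r⟩ h
    simp only [Finset.mem_sigma, Finset.mem_range] at h
    simp only [Sigma.mk.injEq, heq_eq_eq, and_true]
    omega
  · rintro ⟨s, r⟩ h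
    simp only [Finset.mem_sigma, Finset.mem_range] at h
    simp only [Sigma.mk.injEq, heq_eq_eq, and_true]
    omega
  · rintro ⟨s, r⟩ h
    simp only [Finset.mem_sigma, Finset.mem_range] at h
    simp only [map_smul, map_mul, smul_mul_assoc, smul_smul]
    have e1 : r + (D - s) - r = D - s := by omega
    have e2 : D + 1 + p - s = p + 1 + (D - s) := by omega
    have e3 : p + (r + (D - s)) - r + 1 = p + 1 + (D - s) := by omega
    rw [e1, e2, e3, pow_add]

/-- The coefficients of the generating series are the descendent vector potentials. -/
theorem coeff_altSeries_mul_reducedSeries {D : ℕ} (hD : 1 ≤ D) (i : ℕ) (ν β : Fin N) :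
    PowerSeries.coeff i (altSeries (fun e => K.reducedMatrix hv D (K.Om e)) *
      K.reducedSeries hv D) ν β =
      (-1 : ℂ) ^ ((i : ℤ) - D - 1 + 1) • reduction N 𝒪 D (K.potential v ν ((i : ℤ) - D - 1)) := by
  by_cases hi : i ≤ D
  · obtain ⟨k, rfl⟩ := Nat.exists_eq_add_of_le hi
    rw [K.coeff_altSeries_mul_reducedSeries_low hv hi, Nat.add_sub_cancel_left]
    -- With d = -k - 1 the prefactor (-1)^{d+1} cancels the sign (-1)^k built into the potentials of
    -- negative index.
    have e1 : (i : ℤ) - (i + k : ℕ) - 1 = Int.negSucc k := by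
      rw [Int.negSucc_eq]; push_cast; ring
    have e2 : Int.negSucc k + 1 = -(k : ℤ) := by rw [Int.negSucc_eq]; ring
    rw [e1, e2]
    change reduction N 𝒪 (i + k) (K.shiftedVar ν k) =
      _ • reduction N 𝒪 (i + k) ((-1) ^ k * K.shiftedVar ν k)
    have e3 : ((-1 : DescRing N 𝒪) ^ k * K.shiftedVar ν k) = (-1 : ℂ) ^ k • K.shiftedVar ν k := by
      rw [Algebra.smul_def]; simp
    rw [e3, map_smul, smul_smul, zpow_neg, zpow_natCast, inv_mul_cancel₀ (by simp), one_smul]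
  · obtain ⟨p, rfl⟩ := Nat.exists_eq_add_of_le (Nat.succ_le_of_lt (not_le.mp hi))
    have e1 : ((D.succ + p : ℕ) : ℤ) - D - 1 = p := by push_cast; ring
    rw [e1, K.coeff_altSeries_mul_reducedSeries_high hv D p, K.reduction_potential_nonneg hv hD]
    have e2 : ((p : ℤ) + 1) = ((p + 1 : ℕ) : ℤ) := by push_cast; rfl
    rw [e2, zpow_natCast, Matrix.smul_apply, Matrix.sum_apply]
    rfl

/-- The indices of the terms of the Virasoro expression that do not vanish modulo the variables
`t^*_d`, `d > D`. -/
def virasoroIndices (N D L : ℕ) : Finset (Fin N × Fin N × ℕ × ℤ) :=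
  Finset.univ ×ˢ Finset.univ ×ˢ Finset.range (L + 1) ×ˢ
    (Finset.range (L + 1)).image fun i : ℕ => (i : ℤ) - D - 1

theorem mu_sub_smul (lam d : ℂ) :
    mu X lam - d • 1 = Matrix.diagonal X.q + (lam - 3 / 2 - d) • 1 := by
  rw [mu, ← Matrix.diagonal_one, ← Matrix.diagonal_smul, ← Matrix.diagonal_smul,
    Matrix.diagonal_add, Matrix.diagonal_sub]
  congr 1
  funext α
  simp
  ring

theorem nonnegGraded_virP (lam d : ℂ) (j : ℕ) :
    NonnegGraded X.q (virP (mu X lam - d • 1) K.Rtot j) := by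
  rw [mu_sub_smul, ← Matrix.diagonal_one, ← Matrix.diagonal_smul, Matrix.diagonal_add]
  exact K.nonnegGraded_Rtot.virP j

/-- P_m has entries of non-negative degree only, and m - k - d is the degree selected; this bounds k
+ d from above. -/
theorem virasoroTerm_eq_zero {lam : ℂ} {m : ℤ} {α γ ν : Fin N} {k : ℕ} {d : ℤ}
    (h : m - k - d < 0) : K.virasoroTerm v lam m α (γ, ν, k, d) = 0 := by
  have e : m - 1 - ((k : ℤ) - 1) - d = m - k - d := by ring
  rw [virasoroTerm]
  simp only [e]
  rw [(K.nonnegGraded_virP lam d _).qPart_of_neg h]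
  simp

/-- For d < -D - 1 the potential is, up to sign, a time of index above D, which is zero in the
quotient. For the other d the bound on k + d leaves finitely many indices. -/
theorem virasoroTerm_mem {D j : ℕ} (hD : 1 ≤ D) (lam : ℂ) (α : Fin N)
    (i : Fin N × Fin N × ℕ × ℤ) (hi : i ∉ virasoroIndices N D (D + j)) :
    K.virasoroTerm v lam ((j : ℤ) - 1) α i ∈ vanishingIdeal 𝒪 (lowExponents N D) := by
  obtain ⟨γ, ν, k, d⟩ := i
  by_cases hd : d < -D - 1
  · obtain ⟨n, rfl⟩ : ∃ n : ℕ, d = Int.negSucc n := ⟨(-d - 1).toNat, by omega⟩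
    have hn : D < n := by omega
    rw [virasoroTerm, Algebra.smul_def]
    exact Ideal.mul_mem_left _ _ (Ideal.mul_mem_left _ _
      (Ideal.mul_mem_left _ _ (K.shiftedVar_mem hD ν hn)))
  · obtain ⟨i, rfl⟩ : ∃ i : ℕ, d = (i : ℤ) - D - 1 := ⟨(d + D + 1).toNat, by omega⟩
    rw [K.virasoroTerm_eq_zero]
    · exact Ideal.zero_mem _
    · by_contra hcon
      apply hi
      simp only [virasoroIndices, Finset.mem_product, Finset.mem_univ, true_and, Finset.mem_range,
        Finset.mem_image]
      exact ⟨by omega, i, by omega, rfl⟩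

theorem reduction_sum_virasoroTerm {v : Fin N → DescRing N 𝒪} (hv : K.IsTopologicalSolution v)
    (n j : ℕ) (lam : ℂ) (α : Fin N) :
    ∑ i ∈ virasoroIndices N (n + 1) (n + 1 + j),
      reduction N 𝒪 (n + 1) (K.virasoroTerm v lam ((j : ℤ) - 1) α i) = 0 := by
  set D := n + 1 with hDef
  have hD : 1 ≤ D := by omega
  -- Vectors were encoded as matrices with equal columns, so any column of the matrix identity gives
  -- the claim; column 0 is read off.
  have h := congrFun (congrFun (sum_virP_mul_eq_zero K.nonnegGraded_Rtot
    (K.reduced_Lo_mul_Om hv D) (K.reduced_conj hv D) (K.coeff_zero_reduced_Lo hv D) D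
    (K.coeff_reducedSeries_eq_zero hv n) lam j) α) 0
  rw [Matrix.zero_apply, Matrix.sum_apply, Finset.Nat.sum_antidiagonal_eq_sum_range_succ_mk] at h
  rw [← h, virasoroIndices, Finset.sum_product, Finset.sum_congr rfl fun γ _ =>
    Finset.sum_product _ _ _]
  simp only [Finset.sum_product, Matrix.sum_apply]
  have hinj : Function.Injective fun i : ℕ => (i : ℤ) - D - 1 := fun a b hab => by
    simpa using hab
  simp only [Finset.sum_image (hinj.injOn)]
  have key : ∀ k ∈ Finset.range (D + j + 1), ∀ i ∈ Finset.range (D + j + 1),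
      (∑ γ, ∑ ν, reduction N 𝒪 D
        (K.virasoroTerm v lam ((j : ℤ) - 1) α (γ, ν, k, (i : ℤ) - D - 1))) =
      if i ∈ Finset.range (D + j - k + 1) then
        (PowerSeries.coeff k (PowerSeries.mk fun e => K.reducedMatrix hv D (K.Lo e)) *
          (constMatrix (ReducedRing N 𝒪 D) (qPart X.q ((D + j - k - i : ℕ) : ℤ)
            (virP (Matrix.diagonal X.q + (lam - 3 / 2 - ((i : ℂ) - D - 1)) • 1) K.Rtot j)) *
          PowerSeries.coeff i (altSeries (fun e => K.reducedMatrix hv D (K.Om e)) *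
            K.reducedSeries hv D))) α 0 else 0 := by
    intro k hk i hi
    rw [Finset.mem_range] at hk hi
    split_ifs with hik
    · rw [Finset.mem_range] at hik
      rw [Matrix.mul_apply]
      refine Finset.sum_congr rfl fun γ _ => ?_
      rw [Matrix.mul_apply, Finset.mul_sum]
      refine Finset.sum_congr rfl fun ν _ => ?_
      rw [K.coeff_altSeries_mul_reducedSeries hv hD, PowerSeries.coeff_mk, reducedMatrix_apply,
        virasoroTerm]
      have e1 : (j : ℤ) - 1 - 1 - ((k : ℤ) - 1) - ((i : ℤ) - D - 1) =
          ((D + j - k - i : ℕ) : ℤ) := by omega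
      have e2 : ((j : ℤ) - 1 + 1).toNat = j := by omega
      simp only [e1, e2, mu_sub_smul]
      have e3 : (((i : ℤ) - D - 1 : ℤ) : ℂ) = (i : ℂ) - D - 1 := by push_cast; rfl
      rw [e3, map_smul, map_mul, ← K.substHom_apply hv, constMatrix, Matrix.map_apply,
        ← Algebra.smul_def, smul_smul, mul_smul_comm, mul_comm (qPart _ _ _ _ _)]
    -- The rectangular index set contains pairs with k + i > D + j; their terms vanish by the
    -- grading.
    · rw [Finset.mem_range] at hik
      refine Finset.sum_eq_zero fun γ _ => Finset.sum_eq_zero fun ν _ => ?_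
      rw [K.virasoroTerm_eq_zero (by omega), map_zero]
  rw [Finset.sum_congr rfl fun γ _ => Finset.sum_comm, Finset.sum_comm]
  refine Finset.sum_congr rfl fun k hk => ?_
  rw [Finset.sum_congr rfl fun γ _ => Finset.sum_comm, Finset.sum_comm,
    Finset.sum_congr rfl (key k hk), Finset.sum_ite_mem, Finset.inter_eq_right.mpr]
  exact Finset.range_mono (by omega)

theorem exists_mem_lowExponents (n : Fin N × ℕ →₀ ℕ) : ∃ D, n ∈ lowExponents N (D + 1) := by
  refine ⟨n.support.sup Prod.snd, fun i hi => ?_⟩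
  by_contra h
  have := Finset.le_sup (f := Prod.snd) (Finsupp.mem_support_iff.mpr h)
  omega

theorem virasoro {v : Fin N → DescRing N 𝒪} (hv : K.IsTopologicalSolution v) (lam : ℂ) (m : ℤ)
    (hm : -1 ≤ m) (α : Fin N) :
    LocallyFiniteFamily (K.virasoroTerm v lam m α) ∧ K.virasoroExpr v lam m α = 0 := by
  obtain ⟨j, rfl⟩ : ∃ j : ℕ, m = (j : ℤ) - 1 := ⟨(m + 1).toNat, by omega⟩
  constructor
  · intro n
    obtain ⟨D, hD⟩ := exists_mem_lowExponents n
    refine (virasoroIndices N (D + 1) (D + 1 + j)).finite_toSet.subset fun i hi => ?_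
    by_contra hcon
    exact hi (K.virasoroTerm_mem (Nat.le_add_left 1 D) lam α i hcon n hD)
  · ext n
    -- A monomial involves finitely many times, so its coefficient is already visible in one of the
    -- quotients.
    obtain ⟨D, hD⟩ := exists_mem_lowExponents n
    have h := reduction_formalSum _ fun i hi =>
      K.virasoroTerm_mem (v := v) (j := j) (Nat.le_add_left 1 D) lam α i hi
    rw [K.reduction_sum_virasoroTerm hv, reduction_eq_zero] at h
    exact h n hD

end ConformalFlatFManifold.Calibration

end

end

theorem proposition4p9 {N : ℕ} [NeZero N] :
    (∀ (M : Set (Fin N → ℂ)) (hM : IsOpen M) (_ : SimplyConnectedSpace M)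
        (X : ConformalFlatFManifold (analyticFunctions M hM)) (K : X.Calibration)
        (v : Fin N → DescRing N (AnalyticRing M)) (_ : K.IsTopologicalSolution v)
        (lam : ℂ) (m : ℤ) (_ : -1 ≤ m) (α : Fin N),
        LocallyFiniteFamily (K.virasoroTerm v lam m α) ∧ K.virasoroExpr v lam m α = 0) ∧
    (∀ (torig : Fin N → ℂ)
        (X : ConformalFlatFManifold (formalFunctions torig)) (K : X.Calibration)
        (v : Fin N → DescRing N (MvPowerSeries (Fin N) ℂ)) (_ : K.IsTopologicalSolution v)
        (lam : ℂ) (m : ℤ) (_ : -1 ≤ m) (α : Fin N),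
        LocallyFiniteFamily (K.virasoroTerm v lam m α) ∧ K.virasoroExpr v lam m α = 0) :=
  ⟨fun _ _ _ _ K _ hv lam m hm α => K.virasoro hv lam m hm α,
    fun _ _ K _ hv lam m hm α => K.virasoro hv lam m hm α⟩
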